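/- **Theorem.** Let $n,p\ge 1$, $m_1,\dots,m_n\ge 1$, and let $f_{i,j}:\mathbb R^p\to\mathbb R$ ($1\le i\le n$, $1\le j\le m_i$) be differentiable with $\ell$-Lipschitz gradients. Put $f_i=\frac1{m_i}\sum_j f_{i,j}$ and $F=\frac1n\sum_i f_i$, and let $F$ be $\mu$-strongly convex with $\mu>0$. Write $M=\max_i m_i$, $m=\min_i m_i$, $\kappa=\ell/\mu$. Let $\underline A$ (row-stochastic) and $\underline B$ (column-stochastic) be nonnegative $n\times n$ weight matrices over a strongly connected directed graph on $n$ nodes: the $(i,r)$ entry is nonzero exactly if $r=i$ or node $i$ receives information from node $r$. Let $\boldsymbol\pi_r,\boldsymbol\pi_c$ be the left Perron vector of $\underline A$ and the right Perron vector of $\underline B$ (for the eigenvalue $1$, with entries summing to $1$), $h_r,h_c$ the ratios of their largest to their smallest entries, $\sigma_A$ the matrix norm of $\underline A-\mathbf 1\boldsymbol\pi_r^\top$ induced by $\|y\|^2=\sum_i(\boldsymbol\pi_r)_i y_i^2$, and $\sigma_B$ the matrix norm of $\underline B-\boldsymbol\pi_c\mathbf 1^\top$ induced by $\|y\|^2=\sum_i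 y_i^2/(\boldsymbol\pi_c)_i$. Let $$\psi=\frac{\sqrt{h_rh_c}}{n\,\boldsymbol\pi_r^\top\boldsymbol\pi_c},\qquad \overline\alpha=\min\Big\{\frac1{35\ell\sqrt{h_rh_c}},\ \frac{m}{288Mn\kappa\ell\,\boldsymbol\pi_r^\top\boldsymbol\pi_c},\ \frac1{9\mu M\,\boldsymbol\pi_r^\top\boldsymbol\pi_c}\Big\},$$ $$\overline d=\frac{\log\Big(\frac{1265\kappa}{\boldsymbol\pi_r^\top\boldsymbol\pi_c}\sqrt{\frac{nMh_c}{m}}\Big)}{\log\frac1{\sigma_B}},\qquad \overline c=\frac{\log\Big(\frac{90512\,nM\kappa}{m(1-\sigma_B^{2d})}\sqrt{\frac{h_rh_c}{\boldsymbol\pi_r^\top\boldsymbol\pi_c}}\Big)}{\log\frac1{\sigma_A}},$$ where $\overline d=0$ if $\sigma_B=0$ and $\overline c=0$ if $\sigma_A=0$, and let $c,d\ge1$ be integers with $d\ge\overline d$ and $c\ge\overline c$ (for instance $d=\lceil\overline d\,\rceil$ and $c=\lceil\overline c\,\rceil$, or $1$ where this is $0$). AB-SAGA with step size $\alpha$,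 started at arbitrary $\mathbf x_1^0,\dots,\mathbf x_n^0\in\mathbb R^p$ with $\mathbf w_i^0=\mathbf g_i^0=\nabla f_i(\mathbf x_i^0)$ and $\mathbf v_{i,j}^1=\mathbf x_i^0$, iterates for $k=0,1,2,\dots$, with independent indices $s_i^{k+1}$ uniform on $\{1,\dots,m_i\}$, $$\mathbf x_i^{k+1}=\sum_r(\underline A^c)_{ir}(\mathbf x_r^k-\alpha\mathbf w_r^k),\qquad \mathbf w_i^{k+1}=\sum_r(\underline B^d)_{ir}(\mathbf w_r^k+\mathbf g_r^{k+1}-\mathbf g_r^k),$$ $$\mathbf g_i^{k+1}=\nabla f_{i,s}(\mathbf x_i^{k+1})-\nabla f_{i,s}(\mathbf v_{i,s}^{k+1})+\frac1{m_i}\sum_j\nabla f_{i,j}(\mathbf v_{i,j}^{k+1})\quad(s=s_i^{k+1}),$$ $\mathbf v_{i,j}^{k+2}=\mathbf x_i^{k+1}$ if $j=s_i^{k+1}$, and $\mathbf v_{i,j}^{k+2}=\mathbf v_{i,j}^{k+1}$ otherwise. The gradients $\nabla f_{i,j}(\mathbf v_{i,j})$ are stored, so node $i$ computes $m_i$ component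 gradients at the start and one per iteration; each iteration uses $c+d$ communication rounds. Then $\sigma_A,\sigma_B<1$, $\psi\ge1$, $\overline\alpha>0$, $F$ has a unique global minimizer $\mathbf x^*$, and: 1. For every $\alpha\in(0,\overline\alpha)$ there is $\gamma\in[0,1)$, and for all initial points a constant $C$, such that $\mathbb E\|\mathbf x_i^k-\mathbf x^*\|^2\le C\gamma^k$ for all $k\ge0$ and all nodes $i$. 2. For $\alpha=\overline\alpha$, AB-SAGA reaches an $\varepsilon$-optimal solution in $O\big(\max\{\kappa\psi,\ \kappa^2M/m,\ M\}\log\frac1\varepsilon\big)$ gradient computations per node. That is, there is a universal constant $K$ such that, for every instance and all initial points, there is $\varepsilon_0\in(0,1)$ such that for every $\varepsilon\in(0,\varepsilon_0]$ there is an iteration $T$ by which every node has computed at most $K\max\{\kappa\psi,\kappa^2M/m,M\}\log\frac1\varepsilon$ component gradients, and $\mathbb E\|\mathbf x_i^k-\mathbf x^*\|^2\le\varepsilon$ for all $k\ge T$ and all $i$. -/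

import Mathlib

open MeasureTheory ProbabilityTheory

namespace ABSAGA

noncomputable section

/-- The decision space, with its Euclidean norm. -/
abbrev Vec (p : ℕ) : Type := EuclideanSpace ℝ (Fin p)

/-! ### The optimization problem -/

/-- The local cost of node `i`: the average of its `m i` component costs. -/
def localCost {n p : ℕ} {m : Fin n → ℕ} (f : (i : Fin n) → Fin (m i) → Vec p → ℝ)
    (i : Fin n) (x : Vec p) : ℝ :=
  (1 / (m i : ℝ)) * ∑ j, f i j x

/-- The global cost: the average of the local costs. -/
def globalCost {n p : ℕ} {m : Fin n → ℕ} (f : (i : Fin n) → Fin (m i) → Vec p → ℝ)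
    (x : Vec p) : ℝ :=
  (1 / (n : ℝ)) * ∑ i, localCost f i x

/-- `ℓ`-smoothness: differentiable with `ℓ`-Lipschitz gradient. -/
def IsSmooth {p : ℕ} (ℓ : ℝ) (h : Vec p → ℝ) : Prop :=
  Differentiable ℝ h ∧ ∀ x y, ‖gradient h x - gradient h y‖ ≤ ℓ * ‖x - y‖

/-- The largest local sample size. -/
def maxSize {n : ℕ} (m : Fin n → ℕ) : ℕ := ⨆ i, m i

/-- The smallest local sample size. -/
def minSize {n : ℕ} (m : Fin n → ℕ) : ℕ := ⨅ i, m i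

/-! ### The network -/

/-- Every node reaches every other node along directed edges. -/
def StronglyConnected {n : ℕ} (G : Digraph (Fin n)) : Prop :=
  ∀ i j, Relation.ReflTransGen G.Adj i j

/-- Nonnegative weights supported exactly on the links of the network: node `i` gives a positive
weight to itself and to the nodes it receives information from, and weight zero to all others. -/
def IsWeightMatrix {n : ℕ} (G : Digraph (Fin n)) (W : Matrix (Fin n) (Fin n) ℝ) : Prop :=
  (∀ i r, 0 ≤ W i r) ∧ ∀ i r, W i r ≠ 0 ↔ (r = i ∨ G.Adj r i)

/-- Row-stochastic weights. -/
def IsRowWeights {n : ℕ} (G : Digraph (Fin n)) (A : Matrix (Fin n) (Fin n) ℝ) : Prop :=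
  IsWeightMatrix G A ∧ ∀ i, ∑ r, A i r = 1

/-- Column-stochastic weights. -/
def IsColWeights {n : ℕ} (G : Digraph (Fin n)) (B : Matrix (Fin n) (Fin n) ℝ) : Prop :=
  IsWeightMatrix G B ∧ ∀ r, ∑ i, B i r = 1

/-- The left eigenvector for the eigenvalue `1`, normalized to have entries summing to `1`. -/
def IsLeftPerron {n : ℕ} (A : Matrix (Fin n) (Fin n) ℝ) (π : Fin n → ℝ) : Prop :=
  Matrix.vecMul π A = π ∧ ∑ i, π i = 1

/-- The right eigenvector for the eigenvalue `1`, normalized to have entries summing to `1`. -/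
def IsRightPerron {n : ℕ} (B : Matrix (Fin n) (Fin n) ℝ) (π : Fin n → ℝ) : Prop :=
  Matrix.mulVec B π = π ∧ ∑ i, π i = 1

/-- The operator norm of a matrix for the Euclidean norm. -/
def opNorm {n : ℕ} (X : Matrix (Fin n) (Fin n) ℝ) : ℝ :=
  ‖Matrix.toEuclideanCLM (n := Fin n) (𝕜 := ℝ) X‖

/-- `σ_A`: the matrix norm of `A - 1 πᵀ` induced by the vector norm
`‖y‖² = ∑ i, π i * (y i)²`. -/
def sigmaRow {n : ℕ} (A : Matrix (Fin n) (Fin n) ℝ) (π : Fin n → ℝ) : ℝ :=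
  opNorm (Matrix.diagonal (fun i => √(π i)) * (A - Matrix.of fun _ j => π j) *
    Matrix.diagonal (fun i => (√(π i))⁻¹))

/-- `σ_B`: the matrix norm of `B - π 1ᵀ` induced by the vector norm
`‖y‖² = ∑ i, (y i)² / π i`. -/
def sigmaCol {n : ℕ} (B : Matrix (Fin n) (Fin n) ℝ) (π : Fin n → ℝ) : ℝ :=
  opNorm (Matrix.diagonal (fun i => (√(π i))⁻¹) * (B - Matrix.of fun i _ => π i) *
    Matrix.diagonal (fun i => √(π i)))

/-- Ratio of the largest to the smallest entry. -/
def spread {n : ℕ} (π : Fin n → ℝ) : ℝ := (⨆ i, π i) / (⨅ i, π i)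

/-- The directivity constant `ψ`. -/
def directivity {n : ℕ} (πr πc : Fin n → ℝ) : ℝ :=
  √(spread πr * spread πc) / ((n : ℝ) * dotProduct πr πc)

/-- The step-size bound `ᾱ`, with `κ = ℓ / μ`. -/
def stepBound {n : ℕ} (m : Fin n → ℕ) (μ ℓ : ℝ) (πr πc : Fin n → ℝ) : ℝ :=
  min (1 / (35 * ℓ * √(spread πr * spread πc)))
    (min
      ((minSize m : ℝ) / (288 * (maxSize m : ℝ) * (n : ℝ) * (ℓ / μ) * ℓ * dotProduct πr πc))
      (1 / (9 * μ * (maxSize m : ℝ) * dotProduct πr πc)))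

/-- The bound `d̄` on the communication rounds per `w`-update. It takes the value `0`
if `sigmaCol B πc = 0`. -/
def dBar {n : ℕ} (m : Fin n → ℕ) (μ ℓ : ℝ) (B : Matrix (Fin n) (Fin n) ℝ)
    (πr πc : Fin n → ℝ) : ℝ :=
  Real.log (1265 * (ℓ / μ) / dotProduct πr πc *
      √((n : ℝ) * (maxSize m : ℝ) * spread πc / (minSize m : ℝ))) /
    Real.log (1 / sigmaCol B πc)

/-- The bound `c̄` on the communication rounds per `x`-update, given the number `d` of rounds
per `w`-update. It takes the value `0` if `sigmaRow A πr = 0`. -/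
def cBar {n : ℕ} (m : Fin n → ℕ) (μ ℓ : ℝ) (A B : Matrix (Fin n) (Fin n) ℝ)
    (πr πc : Fin n → ℝ) (d : ℕ) : ℝ :=
  Real.log (90512 * (n : ℝ) * (maxSize m : ℝ) * (ℓ / μ) /
        ((minSize m : ℝ) * (1 - sigmaCol B πc ^ (2 * d))) *
      √(spread πr * spread πc / dotProduct πr πc)) /
    Real.log (1 / sigmaRow A πr)

/-- The complexity factor `max {κψ, κ²M/m, M}`, with `κ = ℓ / μ`. -/
def complexityFactor {n : ℕ} (m : Fin n → ℕ) (μ ℓ : ℝ) (πr πc : Fin n → ℝ) : ℝ :=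
  max ((ℓ / μ) * directivity πr πc)
    (max ((ℓ / μ) ^ 2 * (maxSize m : ℝ) / (minSize m : ℝ)) (maxSize m : ℝ))

/-! ### The algorithm -/

/-- The state of all nodes after an iteration. `table i j` is the component gradient which node `i`
stores for component `j`, and `v i j` is the point at which it was evaluated; `evals i` counts the
component gradients that node `i` has evaluated so far, and `rounds` the communication rounds. -/
structure State (n p : ℕ) (m : Fin n → ℕ) where
  x : Fin n → Vec p
  w : Fin n → Vec p
  g : Fin n → Vec p
  v : (i : Fin n) → Fin (m i) → Vec p
  table : (i : Fin n) → Fin (m i) → Vec p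
  evals : Fin n → ℕ
  rounds : ℕ

/-- Initialization: each node evaluates its `m i` component gradients at its initial point. -/
def initState {n p : ℕ} {m : Fin n → ℕ} (f : (i : Fin n) → Fin (m i) → Vec p → ℝ)
    (x₀ : Fin n → Vec p) : State n p m where
  x := x₀
  w := fun i => (1 / (m i : ℝ)) • ∑ j, gradient (f i j) (x₀ i)
  g := fun i => (1 / (m i : ℝ)) • ∑ j, gradient (f i j) (x₀ i)
  v := fun i _ => x₀ i
  table := fun i j => gradient (f i j) (x₀ i)
  evals := m
  rounds := 0

/-- The `x`-update `x ← Aᶜ (x - α w)`. -/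
def nextX {n p : ℕ} {m : Fin n → ℕ} (A : Matrix (Fin n) (Fin n) ℝ) (α : ℝ) (c : ℕ)
    (S : State n p m) (i : Fin n) : Vec p :=
  ∑ r, (A ^ c) i r • (S.x r - α • S.w r)

/-- The component gradient that node `i` evaluates at its new point, the index `s i` being drawn. -/
def newGrad {n p : ℕ} {m : Fin n → ℕ} (f : (i : Fin n) → Fin (m i) → Vec p → ℝ)
    (A : Matrix (Fin n) (Fin n) ℝ) (α : ℝ) (c : ℕ) (s : (i : Fin n) → Fin (m i))
    (S : State n p m) (i : Fin n) : Vec p :=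
  gradient (f i (s i)) (nextX A α c S i)

/-- The SAGA gradient estimate at the new point. -/
def nextG {n p : ℕ} {m : Fin n → ℕ} (f : (i : Fin n) → Fin (m i) → Vec p → ℝ)
    (A : Matrix (Fin n) (Fin n) ℝ) (α : ℝ) (c : ℕ) (s : (i : Fin n) → Fin (m i))
    (S : State n p m) (i : Fin n) : Vec p :=
  newGrad f A α c s S i - S.table i (s i) + (1 / (m i : ℝ)) • ∑ j, S.table i j

/-- One iteration, with drawn indices `s`. -/
def step {n p : ℕ} {m : Fin n → ℕ} (f : (i : Fin n) → Fin (m i) → Vec p → ℝ)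
    (A B : Matrix (Fin n) (Fin n) ℝ) (α : ℝ) (c d : ℕ) (s : (i : Fin n) → Fin (m i))
    (S : State n p m) : State n p m where
  x := nextX A α c S
  g := nextG f A α c s S
  w := fun i => ∑ r, (B ^ d) i r • (S.w r + nextG f A α c s S r - S.g r)
  v := fun i => Function.update (S.v i) (s i) (nextX A α c S i)
  table := fun i => Function.update (S.table i) (s i) (newGrad f A α c s S i)
  evals := fun i => S.evals i + 1
  rounds := S.rounds + (c + d)

/-- The state after `k` iterations from the initial points `x₀`, where `s (k + 1) i` is the index
drawn by node `i` in the iteration that leads from `k` to `k + 1`. -/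
def run {n p : ℕ} {m : Fin n → ℕ} (f : (i : Fin n) → Fin (m i) → Vec p → ℝ)
    (A B : Matrix (Fin n) (Fin n) ℝ) (α : ℝ) (c d : ℕ) (x₀ : Fin n → Vec p)
    (s : ℕ → (i : Fin n) → Fin (m i)) : ℕ → State n p m
  | 0 => initState f x₀
  | k + 1 => step f A B α c d (s (k + 1)) (run f A B α c d x₀ s k)

/-- The drawn indices are independent over iterations and nodes, and uniformly distributed. -/
structure IsUniformSampling {n : ℕ} {m : Fin n → ℕ} {Ω : Type*} [MeasurableSpace Ω]
    (P : Measure Ω) (s : ℕ → (i : Fin n) → Ω → Fin (m i)) : Prop where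
  measurable : ∀ k i, Measurable (s k i)
  indep : iIndepFun (fun q : ℕ × Fin n => s q.1 q.2) P
  uniform : ∀ k i j, P (s k i ⁻¹' {j}) = (m i : ENNReal)⁻¹

/-- The random state after `k` iterations. -/
def randomRun {n p : ℕ} {m : Fin n → ℕ} {Ω : Type*} (f : (i : Fin n) → Fin (m i) → Vec p → ℝ)
    (A B : Matrix (Fin n) (Fin n) ℝ) (α : ℝ) (c d : ℕ) (x₀ : Fin n → Vec p)
    (s : ℕ → (i : Fin n) → Ω → Fin (m i)) (k : ℕ) (ω : Ω) : State n p m :=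
  run f A B α c d x₀ (fun t i => s t i ω) k

end

end ABSAGA

open ABSAGA

/-!
The proof is a Lyapunov argument. Every row-stochastic `A` on a strongly connected graph with self
loops contracts the distance to consensus in the norm weighted by its Perron vector `πr`: the defect
in Jensen's inequality vanishes only on constant vectors (`RowPair.sum_sq_lt`), so `σ_A < 1` by
compactness. The column-stochastic `B` is similar, via `diag πc`, to a row-stochastic matrix with
left Perron vector `πc`, which transfers the statement (`ColPair.rowPair`, `ColPair.sigmaCol_eq`).

After an iteration, the next iterates `x` are determined before the next indices are drawn. Five
errors are tracked at that moment: the distance of the weighted mean of `x` from the minimizer, the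
disagreement among the `x i`, the distance of the gradient tables and of the gradient estimates
from the gradients at the minimizer, and the tracking error of `w`. As `∑ w = ∑ g` always holds
(`run_sum_eq`), the weighted mean follows the summed SAGA estimates with the effective step size
`η = n (πrᵀ πc) α`, up to the tracking error. The estimates are unbiased, so strong monotonicity of
`∇F` contracts the optimality error by about `1 - 3ημ/2` (`UniformWeights.descent`), while a table
entry is refreshed with probability at least `1 / M`. All other couplings are small: those through the
estimates by the bound `ημ κ² ≤ m / (288 M)` on the step size, those through the network because
`c` and `d` rounds make `σ_A ^ c` and `σ_B ^ d` small (`Setting.mixing_bounds`). Hence a weighted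
sum of the errors contracts in expectation by `1 - ρ`, `ρ = min (ημ / 2) (1 / (4 M))`
(`lyapunov_contraction`, `Setting.step_contraction`). Independence of the draws is used only between
past and present: of a single draw, only the uniform marginals at the nodes enter
(`IsUniformSampling.integral_run_succ`).

Both claims follow from the resulting bound `C (1 - ρ) ^ k` (`Setting.exists_linear_bound`); for the
complexity, `1 / ρ` is at most `576` times the complexity factor when the step size is maximal. The
minimizer exists because small gradient steps are contractions (`exists_zero_of_monotone`).
-/

namespace ABSAGA

/-! ### Weighted averages -/

lemma sum_smul_sub_mean {ι V : Type*} [Fintype ι] [AddCommGroup V] [Module ℝ V] {w : ι → ℝ}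
    (hw1 : ∑ i, w i = 1) (y : ι → V) : ∑ i, w i • (y i - ∑ r, w r • y r) = 0 := by
  simp_rw [smul_sub]
  rw [Finset.sum_sub_distrib, ← Finset.sum_smul, hw1, one_smul, sub_self]

lemma sum_mul_norm_sub_sq {ι V : Type*} [Fintype ι] [NormedAddCommGroup V]
    [InnerProductSpace ℝ V] {w : ι → ℝ} (hw1 : ∑ i, w i = 1) (y : ι → V) (v : V) :
    ∑ i, w i * ‖y i - v‖ ^ 2
      = ∑ i, w i * ‖y i - ∑ r, w r • y r‖ ^ 2 + ‖∑ r, w r • y r - v‖ ^ 2 := by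
  set b := ∑ r, w r • y r with hb
  have h0 : ∑ i, w i * inner ℝ (y i - b) (b - v) = 0 := by
    simp_rw [← real_inner_smul_left]
    rw [← sum_inner, sum_smul_sub_mean hw1, inner_zero_left]
  have h1 : ∀ i, w i * ‖y i - v‖ ^ 2
      = w i * ‖y i - b‖ ^ 2 + 2 * (w i * inner ℝ (y i - b) (b - v)) + w i * ‖b - v‖ ^ 2 := by
    intro i
    have : y i - v = (y i - b) + (b - v) := by abel
    rw [this, norm_add_sq_real]
    ring
  simp_rw [h1]
  rw [Finset.sum_add_distrib, Finset.sum_add_distrib, ← Finset.mul_sum, h0, ← Finset.sum_mul, hw1]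
  ring

lemma sum_mul_norm_sub_mean_le {ι V : Type*} [Fintype ι] [NormedAddCommGroup V]
    [InnerProductSpace ℝ V] {w : ι → ℝ} (hw1 : ∑ i, w i = 1) (y : ι → V) (v : V) :
    ∑ i, w i * ‖y i - ∑ r, w r • y r‖ ^ 2 ≤ ∑ i, w i * ‖y i - v‖ ^ 2 := by
  rw [sum_mul_norm_sub_sq hw1 y v]
  nlinarith [sq_nonneg ‖∑ r, w r • y r - v‖]

lemma norm_sum_sq_le {ι V : Type*} [Fintype ι] [NormedAddCommGroup V] (y : ι → V) :
    ‖∑ i, y i‖ ^ 2 ≤ Fintype.card ι * ∑ i, ‖y i‖ ^ 2 := by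
  calc ‖∑ i, y i‖ ^ 2 ≤ (∑ i, ‖y i‖) ^ 2 := by gcongr; exact norm_sum_le _ _
    _ ≤ _ := by simpa using sq_sum_le_card_mul_sum_sq (s := Finset.univ) (f := fun i => ‖y i‖)

lemma norm_add_sq_le_two {V : Type*} [NormedAddCommGroup V] (a b : V) :
    ‖a + b‖ ^ 2 ≤ 2 * ‖a‖ ^ 2 + 2 * ‖b‖ ^ 2 := by
  nlinarith [norm_add_le a b, sq_nonneg (‖a‖ - ‖b‖), norm_nonneg (a + b), norm_nonneg a,
    norm_nonneg b]

lemma norm_sub_sq_le_two {V : Type*} [NormedAddCommGroup V] (a b : V) :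
    ‖a - b‖ ^ 2 ≤ 2 * ‖a‖ ^ 2 + 2 * ‖b‖ ^ 2 := by
  simpa [sub_eq_add_neg] using norm_add_sq_le_two a (-b)

/-! ### Perron vectors -/

/-- The support of `W`, seen as a directed graph, is strongly connected. -/
def SupportConnected {n : ℕ} (W : Matrix (Fin n) (Fin n) ℝ) : Prop :=
  ∀ i j, Relation.ReflTransGen (fun a b => W a b ≠ 0) i j

lemma SupportConnected.forall_of_exists {n : ℕ} {W : Matrix (Fin n) (Fin n) ℝ}
    (hW : SupportConnected W) {S : Fin n → Prop} (hS : ∀ i r, W i r ≠ 0 → S i → S r)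
    (h : ∃ i, S i) (j : Fin n) : S j := by
  obtain ⟨i, hi⟩ := h
  have := hW i j
  induction this with
  | refl => exact hi
  | tail _ hbc ih => exact hS _ _ hbc ih

lemma SupportConnected.transpose {n : ℕ} {W : Matrix (Fin n) (Fin n) ℝ}
    (hW : SupportConnected W) : SupportConnected W.transpose := fun i j => by
  have := (Relation.reflTransGen_swap (r := fun a b => W a b ≠ 0) (a := i) (b := j)).2 (hW j i)
  exact this

lemma IsWeightMatrix.supportConnected {n : ℕ} {G : Digraph (Fin n)} (hG : StronglyConnected G)
    {W : Matrix (Fin n) (Fin n) ℝ} (hW : IsWeightMatrix G W) : SupportConnected W := by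
  intro i j
  have h1 := (Relation.reflTransGen_swap (r := G.Adj) (a := i) (b := j)).2 (hG j i)
  exact Relation.ReflTransGen.mono (fun a b hab => (hW.2 a b).2 (Or.inr hab)) _ _ h1

lemma IsWeightMatrix.diag_ne_zero {n : ℕ} {G : Digraph (Fin n)}
    {W : Matrix (Fin n) (Fin n) ℝ} (hW : IsWeightMatrix G W) (i : Fin n) : W i i ≠ 0 :=
  (hW.2 i i).2 (Or.inl rfl)

/-- A fixed vector with positive sum of an irreducible column-stochastic matrix is positive: its
positive part `u` satisfies `u ≤ P u`, and both sides have the same sum, so `P u = u`; the zero set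
of `u` is then closed under the links. -/
lemma perron_pos {n : ℕ} {P : Matrix (Fin n) (Fin n) ℝ} (h0 : ∀ i r, 0 ≤ P i r)
    (h1 : ∀ r, ∑ i, P i r = 1) (hc : SupportConnected P) {π : Fin n → ℝ}
    (hπ : P.mulVec π = π) (hs : ∑ i, π i = 1) (i : Fin n) : 0 < π i := by
  set u : Fin n → ℝ := fun i => max (π i) 0 with hu
  have hu0 : ∀ i, 0 ≤ u i := fun i => le_max_right _ _
  have hle : ∀ i, u i ≤ ∑ r, P i r * u r := by
    intro i
    refine max_le ?_ (Finset.sum_nonneg fun r _ => mul_nonneg (h0 i r) (hu0 r))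
    conv_lhs => rw [← hπ, Matrix.mulVec, dotProduct]
    exact Finset.sum_le_sum fun r _ => mul_le_mul_of_nonneg_left (le_max_left _ _) (h0 i r)
  have hsum : ∑ i, u i = ∑ i, ∑ r, P i r * u r := by
    rw [Finset.sum_comm]
    simp_rw [← Finset.sum_mul, h1, one_mul]
  have heq : ∀ i, u i = ∑ r, P i r * u r := fun i =>
    (Finset.sum_eq_sum_iff_of_le fun i _ => hle i).1 hsum i (Finset.mem_univ i)
  have hne : ∀ i, u i ≠ 0 := by
    by_contra! hex
    have hall : ∀ j, u j = 0 := by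
      refine hc.forall_of_exists (fun i r hir hi => ?_) hex
      have h2 := heq i
      rw [hi] at h2
      have h3 := (Finset.sum_eq_zero_iff_of_nonneg
        (fun r _ => mul_nonneg (h0 i r) (hu0 r))).1 h2.symm r (Finset.mem_univ r)
      exact (mul_eq_zero.1 h3).resolve_left hir
    have : ∑ i, π i ≤ ∑ i, u i := Finset.sum_le_sum fun i _ => le_max_left _ _
    simp only [hall, Finset.sum_const_zero, hs] at this
    linarith
  by_contra hcon
  exact hne i (max_eq_right (not_lt.1 hcon))

/-! ### Contraction by stochastic matrices -/

/-- A row-stochastic matrix `A` with positive diagonal and strongly connected support, together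
with its normalized left fixed vector `π`. -/
structure RowPair {n : ℕ} (A : Matrix (Fin n) (Fin n) ℝ) (π : Fin n → ℝ) : Prop where
  nonneg : ∀ i r, 0 ≤ A i r
  row_sum : ∀ i, ∑ r, A i r = 1
  diag : ∀ i, A i i ≠ 0
  conn : SupportConnected A
  fixed : Matrix.vecMul π A = π
  sum_one : ∑ i, π i = 1
  pos : ∀ i, 0 < π i

/-- A column-stochastic matrix `B` with positive diagonal and strongly connected support, together
with its normalized right fixed vector `π`. -/
structure ColPair {n : ℕ} (B : Matrix (Fin n) (Fin n) ℝ) (π : Fin n → ℝ) : Prop where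
  nonneg : ∀ i r, 0 ≤ B i r
  col_sum : ∀ r, ∑ i, B i r = 1
  diag : ∀ i, B i i ≠ 0
  conn : SupportConnected B
  fixed : Matrix.mulVec B π = π
  sum_one : ∑ i, π i = 1
  pos : ∀ i, 0 < π i

lemma IsRowWeights.rowPair {n : ℕ} {G : Digraph (Fin n)} (hG : StronglyConnected G)
    {A : Matrix (Fin n) (Fin n) ℝ} (hA : IsRowWeights G A) {π : Fin n → ℝ}
    (hπ : IsLeftPerron A π) : RowPair A π where
  nonneg := hA.1.1
  row_sum := hA.2
  diag := hA.1.diag_ne_zero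
  conn := hA.1.supportConnected hG
  fixed := hπ.1
  sum_one := hπ.2
  pos := perron_pos (P := A.transpose) (fun i r => hA.1.1 r i) (fun r => hA.2 r)
    (hA.1.supportConnected hG).transpose (by rw [Matrix.mulVec_transpose]; exact hπ.1) hπ.2

lemma IsColWeights.colPair {n : ℕ} {G : Digraph (Fin n)} (hG : StronglyConnected G)
    {B : Matrix (Fin n) (Fin n) ℝ} (hB : IsColWeights G B) {π : Fin n → ℝ}
    (hπ : IsRightPerron B π) : ColPair B π where
  nonneg := hB.1.1
  col_sum := hB.2
  diag := hB.1.diag_ne_zero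
  conn := hB.1.supportConnected hG
  fixed := hπ.1
  sum_one := hπ.2
  pos := perron_pos hB.1.1 hB.2 (hB.1.supportConnected hG) hπ.1 hπ.2

/-- The similar matrix `D⁻¹ B D`, with `D = diag π`, is row-stochastic with left fixed vector `π`. -/
lemma ColPair.rowPair {n : ℕ} {B : Matrix (Fin n) (Fin n) ℝ} {π : Fin n → ℝ}
    (h : ColPair B π) : RowPair (Matrix.of fun i r => (π i)⁻¹ * B i r * π r) π where
  nonneg i r := by
    have := h.nonneg i r; have := (h.pos i).le; have := (h.pos r).le
    simp only [Matrix.of_apply]; positivity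
  row_sum i := by
    have h1 := congrFun h.fixed i
    simp only [Matrix.mulVec, dotProduct] at h1
    simp only [Matrix.of_apply, mul_assoc, ← Finset.mul_sum, h1]
    exact inv_mul_cancel₀ (h.pos i).ne'
  diag i := by
    simp only [Matrix.of_apply]
    exact mul_ne_zero (mul_ne_zero (inv_ne_zero (h.pos i).ne') (h.diag i)) (h.pos i).ne'
  conn i j := Relation.ReflTransGen.mono (fun a b hab => by
    simp only [Matrix.of_apply]
    exact mul_ne_zero (mul_ne_zero (inv_ne_zero (h.pos a).ne') hab) (h.pos b).ne') _ _ (h.conn i j)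
  fixed := by
    ext r
    have : ∀ i, π i * ((π i)⁻¹ * B i r * π r) = B i r * π r := fun i => by
      have := (h.pos i).ne'; field_simp
    simp only [Matrix.vecMul, dotProduct, Matrix.of_apply, this, ← Finset.sum_mul, h.col_sum,
      one_mul]
  sum_one := h.sum_one
  pos := h.pos

lemma ColPair.sigmaCol_eq {n : ℕ} {B : Matrix (Fin n) (Fin n) ℝ} {π : Fin n → ℝ}
    (h : ColPair B π) :
    sigmaCol B π = sigmaRow (Matrix.of fun i r => (π i)⁻¹ * B i r * π r) π := by
  unfold sigmaCol sigmaRow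
  congr 1
  ext i r
  simp only [Matrix.mul_diagonal, Matrix.diagonal_mul, Matrix.sub_apply, Matrix.of_apply]
  have h1 := Real.mul_self_sqrt (h.pos i).le
  have h2 := Real.mul_self_sqrt (h.pos r).le
  have h3 := (Real.sqrt_pos.2 (h.pos i)).ne'
  have h4 := (Real.sqrt_pos.2 (h.pos r)).ne'
  generalize √(π i) = a at *
  generalize √(π r) = b at *
  rw [← h1, ← h2]
  field_simp

lemma sum_of_vecMul {n : ℕ} {V : Type*} [AddCommGroup V] [Module ℝ V]
    {A : Matrix (Fin n) (Fin n) ℝ} {π : Fin n → ℝ} (h : Matrix.vecMul π A = π) (y : Fin n → V) :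
    ∑ i, π i • ∑ r, A i r • y r = ∑ r, π r • y r := by
  simp_rw [Finset.smul_sum, smul_smul]
  rw [Finset.sum_comm]
  refine Finset.sum_congr rfl fun r _ => ?_
  rw [← Finset.sum_smul]
  congr 1
  exact congrFun h r

/-- The defect in Jensen's inequality for `A` vanishes only on constant vectors, hence `A - 1 πᵀ`
strictly decreases the weighted norm. -/
lemma RowPair.sum_sq_lt {n : ℕ} {A : Matrix (Fin n) (Fin n) ℝ} {π : Fin n → ℝ}
    (h : RowPair A π) {y : Fin n → ℝ} (hy : y ≠ 0) :
    ∑ i, π i * (∑ r, A i r * y r - ∑ r, π r * y r) ^ 2 < ∑ i, π i * y i ^ 2 := by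
  set b := ∑ r, π r * y r with hb
  have jensen : ∀ i, ∑ r, A i r * y r ^ 2 - (∑ r, A i r * y r - b) ^ 2
      = ∑ r, A i r * (y r - ∑ s, A i s * y s) ^ 2 + (2 * b * ∑ r, A i r * y r - b ^ 2) := by
    intro i
    have := sum_mul_norm_sub_sq (h.row_sum i) y 0
    simp only [sub_zero, Real.norm_eq_abs, sq_abs, smul_eq_mul] at this
    rw [this]; ring
  have e1 : ∑ i, π i * ∑ r, A i r * y r ^ 2 = ∑ r, π r * y r ^ 2 := by
    simpa using sum_of_vecMul h.fixed fun r => y r ^ 2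
  have e2 : ∑ i, π i * ∑ r, A i r * y r = b := by
    simpa using sum_of_vecMul h.fixed y
  have key : ∑ i, π i * y i ^ 2 - ∑ i, π i * (∑ r, A i r * y r - b) ^ 2
      = ∑ i, π i * ∑ r, A i r * (y r - ∑ s, A i s * y s) ^ 2 + b ^ 2 := by
    rw [← e1, ← Finset.sum_sub_distrib]
    simp_rw [← mul_sub, jensen, mul_add, mul_sub]
    rw [Finset.sum_add_distrib, Finset.sum_sub_distrib, ← Finset.sum_mul, h.sum_one]
    have : ∀ i, π i * (2 * b * ∑ r, A i r * y r) = 2 * b * (π i * ∑ r, A i r * y r) :=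
      fun i => by ring
    simp_rw [this, ← Finset.mul_sum, e2]
    ring
  have hterm : ∀ i r, 0 ≤ A i r * (y r - ∑ s, A i s * y s) ^ 2 := fun i r =>
    mul_nonneg (h.nonneg i r) (sq_nonneg _)
  have hnn : ∀ i, 0 ≤ π i * ∑ r, A i r * (y r - ∑ s, A i s * y s) ^ 2 := fun i =>
    mul_nonneg (h.pos i).le (Finset.sum_nonneg fun r _ => hterm i r)
  have hge : 0 ≤ ∑ i, π i * ∑ r, A i r * (y r - ∑ s, A i s * y s) ^ 2 :=
    Finset.sum_nonneg fun i _ => hnn i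
  by_contra hcon
  have hz : ∑ i, π i * ∑ r, A i r * (y r - ∑ s, A i s * y s) ^ 2 = 0 := by
    nlinarith [sq_nonneg b]
  have hb0 : b = 0 := by nlinarith [sq_nonneg b]
  have hz2 : ∀ i r, A i r ≠ 0 → y r = ∑ s, A i s * y s := by
    intro i r hir
    have h1 := (Finset.sum_eq_zero_iff_of_nonneg fun i _ => hnn i).1 hz i (Finset.mem_univ i)
    have h2 := (mul_eq_zero.1 h1).resolve_left (h.pos i).ne'
    have h3 := (Finset.sum_eq_zero_iff_of_nonneg fun r _ => hterm i r).1 h2 r (Finset.mem_univ r)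
    have h4 := (mul_eq_zero.1 h3).resolve_left hir
    exact sub_eq_zero.1 (pow_eq_zero_iff (two_ne_zero)|>.1 h4)
  obtain ⟨i₀, hi₀⟩ := Function.ne_iff.1 hy
  have hconst : ∀ j, y j = y i₀ := h.conn.forall_of_exists (S := fun j => y j = y i₀)
    (fun i r hir hi => by rw [← hi, hz2 i r hir, ← hz2 i i (h.diag i)]) ⟨i₀, rfl⟩
  apply hi₀
  simp only [hconst, ← Finset.sum_mul, h.sum_one, one_mul] at hb
  rw [← hb, hb0, Pi.zero_apply]

lemma opNorm_lt_one {E : Type*} [NormedAddCommGroup E] [NormedSpace ℝ E] [FiniteDimensional ℝ E]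
    (L : E →L[ℝ] E) (hL : ∀ x, x ≠ 0 → ‖L x‖ < ‖x‖) : ‖L‖ < 1 := by
  rcases (Metric.sphere (0 : E) 1).eq_empty_or_nonempty with he | hne
  · have : ‖L‖ ≤ 0 := L.opNorm_le_of_unit_norm le_rfl fun x hx => by
      have : x ∈ Metric.sphere (0 : E) 1 := by simpa using hx
      rw [he] at this
      exact this.elim
    linarith
  · have : ProperSpace E := FiniteDimensional.proper ℝ E
    obtain ⟨x₀, hx₀, hmax⟩ := (isCompact_sphere (0 : E) 1).exists_isMaxOn hne
      (f := fun x => ‖L x‖) (by fun_prop)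
    have hx1 : ‖x₀‖ = 1 := by simpa using hx₀
    have h1 : ‖L x₀‖ < 1 := by
      rw [← hx1]
      exact hL x₀ (by intro h; simp [h] at hx1)
    refine lt_of_le_of_lt (L.opNorm_le_of_unit_norm (norm_nonneg _) fun x hx => ?_) h1
    exact hmax (by simpa using hx)

lemma sigmaRow_nonneg {n : ℕ} (A : Matrix (Fin n) (Fin n) ℝ) (π : Fin n → ℝ) :
    0 ≤ sigmaRow A π := norm_nonneg _

lemma sigmaCol_nonneg {n : ℕ} (A : Matrix (Fin n) (Fin n) ℝ) (π : Fin n → ℝ) :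
    0 ≤ sigmaCol A π := norm_nonneg _

lemma norm_sq_conj_apply {n : ℕ} {A : Matrix (Fin n) (Fin n) ℝ} {π : Fin n → ℝ}
    (hπ : ∀ i, 0 ≤ π i) (z : EuclideanSpace ℝ (Fin n)) :
    ‖Matrix.toEuclideanCLM (n := Fin n) (𝕜 := ℝ)
      (Matrix.diagonal (fun i => √(π i)) * (A - Matrix.of fun _ j => π j) *
        Matrix.diagonal (fun i => (√(π i))⁻¹)) z‖ ^ 2
      = ∑ i, π i * (∑ r, A i r * ((√(π r))⁻¹ * z r) - ∑ r, π r * ((√(π r))⁻¹ * z r)) ^ 2 := by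
  rw [EuclideanSpace.norm_sq_eq]
  refine Finset.sum_congr rfl fun i _ => ?_
  rw [Matrix.ofLp_toEuclideanCLM]
  simp only [Matrix.mulVec, dotProduct, Matrix.mul_diagonal, Matrix.diagonal_mul,
    Matrix.sub_apply, Matrix.of_apply, Real.norm_eq_abs, sq_abs]
  rw [← Finset.sum_sub_distrib]
  simp_rw [mul_assoc, ← Finset.mul_sum]
  rw [mul_pow, Real.sq_sqrt (hπ i)]
  congr 2
  exact Finset.sum_congr rfl fun r _ => by ring

lemma RowPair.sigmaRow_lt_one {n : ℕ} {A : Matrix (Fin n) (Fin n) ℝ} {π : Fin n → ℝ}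
    (h : RowPair A π) : sigmaRow A π < 1 := by
  refine opNorm_lt_one _ fun z hz => ?_
  refine lt_of_pow_lt_pow_left₀ 2 (norm_nonneg _) ?_
  rw [norm_sq_conj_apply (fun i => (h.pos i).le)]
  have hs : ∀ i, √(π i) ≠ 0 := fun i => (Real.sqrt_pos.2 (h.pos i)).ne'
  have hne : (fun r => (√(π r))⁻¹ * z r) ≠ 0 := by
    intro h0
    apply hz
    ext i
    have := congrFun h0 i
    simpa [hs i] using this
  refine (h.sum_sq_lt hne).trans_le (le_of_eq ?_)
  rw [EuclideanSpace.norm_sq_eq]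
  refine Finset.sum_congr rfl fun i _ => ?_
  rw [mul_pow, inv_pow, Real.sq_sqrt (h.pos i).le, Real.norm_eq_abs, sq_abs, ← mul_assoc,
    mul_inv_cancel₀ (h.pos i).ne', one_mul]

lemma RowPair.sum_sq_le {n : ℕ} {A : Matrix (Fin n) (Fin n) ℝ} {π : Fin n → ℝ}
    (h : RowPair A π) (y : Fin n → ℝ) :
    ∑ i, π i * (∑ r, A i r * y r - ∑ r, π r * y r) ^ 2
      ≤ sigmaRow A π ^ 2 * ∑ i, π i * y i ^ 2 := by
  have hs : ∀ i, √(π i) ≠ 0 := fun i => (Real.sqrt_pos.2 (h.pos i)).ne'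
  set z : EuclideanSpace ℝ (Fin n) := WithLp.toLp 2 fun i => √(π i) * y i with hz
  have hyz : ∀ r, (√(π r))⁻¹ * z r = y r := fun r => by
    simp only [hz]; rw [← mul_assoc, inv_mul_cancel₀ (hs r), one_mul]
  have h1 := norm_sq_conj_apply (A := A) (fun i => (h.pos i).le) z
  simp only [hyz] at h1
  have h2 : ‖z‖ ^ 2 = ∑ i, π i * y i ^ 2 := by
    rw [EuclideanSpace.norm_sq_eq]
    refine Finset.sum_congr rfl fun i _ => ?_
    simp only [hz, Real.norm_eq_abs, sq_abs, mul_pow, Real.sq_sqrt (h.pos i).le]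
  rw [← h1, ← h2, ← mul_pow]
  gcongr
  exact ContinuousLinearMap.le_opNorm _ _

lemma RowPair.sum_norm_sq_le {n p : ℕ} {A : Matrix (Fin n) (Fin n) ℝ} {π : Fin n → ℝ}
    (h : RowPair A π) (y : Fin n → Vec p) :
    ∑ i, π i * ‖∑ r, A i r • y r - ∑ r, π r • y r‖ ^ 2
      ≤ sigmaRow A π ^ 2 * ∑ i, π i * ‖y i - ∑ r, π r • y r‖ ^ 2 := by
  set b := ∑ r, π r • y r with hb
  have hcoord : ∀ k, ∑ i, π i * (∑ r, A i r * (y r k - b k)) ^ 2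
      ≤ sigmaRow A π ^ 2 * ∑ i, π i * (y i k - b k) ^ 2 := by
    intro k
    have h1 := h.sum_sq_le fun r => y r k - b k
    have h0 : ∑ r, π r * (y r k - b k) = 0 := by
      have := congrArg (fun v : Vec p => v k) (sum_smul_sub_mean h.sum_one y)
      simpa [hb] using this
    simpa [h0] using h1
  have hA : ∀ i, ∑ r, A i r • y r - b = ∑ r, A i r • (y r - b) := by
    intro i
    simp_rw [smul_sub]
    rw [Finset.sum_sub_distrib, ← Finset.sum_smul, h.row_sum, one_smul]
  simp_rw [hA, EuclideanSpace.norm_sq_eq, Finset.mul_sum]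
  rw [Finset.sum_comm]
  conv_rhs => rw [Finset.sum_comm]
  refine Finset.sum_le_sum fun k _ => ?_
  have := hcoord k
  simpa [Finset.mul_sum] using this

lemma sum_pow_succ_smul {n : ℕ} {V : Type*} [AddCommGroup V] [Module ℝ V]
    (A : Matrix (Fin n) (Fin n) ℝ) (c : ℕ) (y : Fin n → V) (i : Fin n) :
    ∑ r, (A ^ (c + 1)) i r • y r = ∑ s, A i s • ∑ r, (A ^ c) s r • y r := by
  simp_rw [pow_succ', Matrix.mul_apply, Finset.sum_smul, Finset.smul_sum, smul_smul]
  exact Finset.sum_comm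

lemma sum_pow_zero_smul {n : ℕ} {V : Type*} [AddCommGroup V] [Module ℝ V]
    (A : Matrix (Fin n) (Fin n) ℝ) (y : Fin n → V) (i : Fin n) :
    ∑ r, (A ^ 0) i r • y r = y i := by
  simp [Matrix.one_apply]

lemma RowPair.sum_pow {n : ℕ} {V : Type*} [AddCommGroup V] [Module ℝ V]
    {A : Matrix (Fin n) (Fin n) ℝ} {π : Fin n → ℝ} (h : RowPair A π) (c : ℕ) (y : Fin n → V) :
    ∑ i, π i • ∑ r, (A ^ c) i r • y r = ∑ r, π r • y r := by
  induction c with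
  | zero => simp_rw [sum_pow_zero_smul]
  | succ c ih => simp_rw [sum_pow_succ_smul]; rw [sum_of_vecMul h.fixed, ih]

/-- `c` rounds of row-stochastic mixing contract the weighted distance to the weighted mean. -/
lemma RowPair.sum_norm_pow_sq_le {n p : ℕ} {A : Matrix (Fin n) (Fin n) ℝ} {π : Fin n → ℝ}
    (h : RowPair A π) (c : ℕ) (y : Fin n → Vec p) :
    ∑ i, π i * ‖∑ r, (A ^ c) i r • y r - ∑ r, π r • y r‖ ^ 2
      ≤ (sigmaRow A π ^ c) ^ 2 * ∑ i, π i * ‖y i - ∑ r, π r • y r‖ ^ 2 := by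
  induction c with
  | zero => simp_rw [sum_pow_zero_smul]; simp
  | succ c ih =>
    have h1 := h.sum_norm_sq_le fun i => ∑ r, (A ^ c) i r • y r
    rw [h.sum_pow] at h1
    simp_rw [sum_pow_succ_smul]
    refine h1.trans ?_
    calc _ ≤ sigmaRow A π ^ 2 * ((sigmaRow A π ^ c) ^ 2
          * ∑ i, π i * ‖y i - ∑ r, π r • y r‖ ^ 2) := by gcongr
      _ = _ := by ring

lemma ColPair.sum_pow {n : ℕ} {V : Type*} [AddCommGroup V] [Module ℝ V]
    {B : Matrix (Fin n) (Fin n) ℝ} {π : Fin n → ℝ} (h : ColPair B π) (d : ℕ) (y : Fin n → V) :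
    ∑ i, ∑ r, (B ^ d) i r • y r = ∑ r, y r := by
  induction d with
  | zero => simp_rw [sum_pow_zero_smul]
  | succ d ih =>
    simp_rw [sum_pow_succ_smul]
    rw [Finset.sum_comm]
    simp_rw [← Finset.sum_smul, h.col_sum, one_smul]
    exact ih

lemma ColPair.sum_norm_sq_le {n p : ℕ} {B : Matrix (Fin n) (Fin n) ℝ} {π : Fin n → ℝ}
    (h : ColPair B π) (y : Fin n → Vec p) :
    ∑ i, (π i)⁻¹ * ‖∑ r, B i r • y r - π i • ∑ r, y r‖ ^ 2
      ≤ sigmaCol B π ^ 2 * ∑ i, (π i)⁻¹ * ‖y i - π i • ∑ r, y r‖ ^ 2 := by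
  have h1 := h.rowPair.sum_norm_sq_le fun i => (π i)⁻¹ • y i
  have hπ : ∀ i, π i ≠ 0 := fun i => (h.pos i).ne'
  have hm : ∑ r, π r • (π r)⁻¹ • y r = ∑ r, y r :=
    Finset.sum_congr rfl fun r _ => by rw [smul_smul, mul_inv_cancel₀ (hπ r), one_smul]
  have hscale : ∀ i, ∀ u v : Vec p, u = π i • v → (π i)⁻¹ * ‖u‖ ^ 2 = π i * ‖v‖ ^ 2 := by
    rintro i u v rfl
    rw [norm_smul, mul_pow, Real.norm_eq_abs, sq_abs]
    have := hπ i
    field_simp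
  rw [hm, ← h.sigmaCol_eq] at h1
  refine le_trans (le_of_eq ?_) (h1.trans (le_of_eq ?_))
  · refine Finset.sum_congr rfl fun i _ => hscale i _ _ ?_
    rw [smul_sub]
    refine congrArg (fun v : Vec p => v - π i • ∑ r, y r) ?_
    rw [Finset.smul_sum]
    refine (Finset.sum_congr rfl fun r _ => ?_)
    rw [Matrix.of_apply, smul_smul, smul_smul]
    refine congrArg (fun a : ℝ => a • y r) ?_
    have := hπ i; have := hπ r
    field_simp
  · congr 1
    refine Finset.sum_congr rfl fun i _ => (hscale i _ _ ?_).symm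
    rw [smul_sub, smul_smul, mul_inv_cancel₀ (hπ i), one_smul]

/-- `d` rounds of column-stochastic mixing contract the weighted distance to the multiple of the
Perron vector that has the same sum. -/
lemma ColPair.sum_norm_pow_sq_le {n p : ℕ} {B : Matrix (Fin n) (Fin n) ℝ} {π : Fin n → ℝ}
    (h : ColPair B π) (d : ℕ) (y : Fin n → Vec p) :
    ∑ i, (π i)⁻¹ * ‖∑ r, (B ^ d) i r • y r - π i • ∑ r, y r‖ ^ 2
      ≤ (sigmaCol B π ^ d) ^ 2 * ∑ i, (π i)⁻¹ * ‖y i - π i • ∑ r, y r‖ ^ 2 := by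
  induction d with
  | zero => simp_rw [sum_pow_zero_smul]; simp
  | succ d ih =>
    have h1 := h.sum_norm_sq_le fun i => ∑ r, (B ^ d) i r • y r
    rw [h.sum_pow] at h1
    simp_rw [sum_pow_succ_smul]
    refine h1.trans ?_
    calc _ ≤ sigmaCol B π ^ 2 * ((sigmaCol B π ^ d) ^ 2
          * ∑ i, (π i)⁻¹ * ‖y i - π i • ∑ r, y r‖ ^ 2) := by gcongr
      _ = _ := by ring

/-! ### Strongly convex costs -/

lemma strongConvex_first_order {p : ℕ} {F : Vec p → ℝ} {μ : ℝ}
    (hF : StrongConvexOn Set.univ μ F) {x g : Vec p} (hg : HasGradientAt F g x) (y : Vec p) :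
    F x + inner ℝ g (y - x) + μ / 2 * ‖y - x‖ ^ 2 ≤ F y := by
  have hline : HasDerivAt (fun t : ℝ => x + t • (y - x)) (y - x) 0 := by
    simpa using ((hasDerivAt_id (0 : ℝ)).smul_const (y - x)).const_add x
  have hd : HasDerivAt (fun t : ℝ => F (x + t • (y - x))) (inner ℝ g (y - x)) 0 := by
    have h1 : HasFDerivAt F (InnerProductSpace.toDual ℝ (Vec p) g) (x + (0 : ℝ) • (y - x)) := by
      simpa using hg.hasFDerivAt
    have h2 := h1.comp_hasDerivAt (0 : ℝ) hline
    rw [InnerProductSpace.toDual_apply_apply] at h2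
    exact h2
  have hslope := hd.tendsto_slope_zero_right
  have hlim : Filter.Tendsto (fun t : ℝ => F y - F x - (1 - t) * (μ / 2 * ‖y - x‖ ^ 2))
      (nhdsWithin 0 (Set.Ioi 0)) (nhds (F y - F x - (1 - 0) * (μ / 2 * ‖y - x‖ ^ 2))) := by
    refine Filter.Tendsto.mono_left (Continuous.tendsto ?_ 0) nhdsWithin_le_nhds
    fun_prop
  have := le_of_tendsto_of_tendsto hslope hlim ?_
  · linarith
  · filter_upwards [Ioo_mem_nhdsGT (show (0 : ℝ) < 1 from one_pos)] with t ht
    have h2 := hF.2 (Set.mem_univ x) (Set.mem_univ y) (sub_nonneg.2 ht.2.le) ht.1.le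
      (sub_add_cancel 1 t)
    have h3 : (1 - t) • x + t • y = x + t • (y - x) := by
      rw [sub_smul, one_smul, smul_sub]; abel
    rw [h3, norm_sub_rev] at h2
    simp only [zero_add, zero_smul, add_zero, smul_eq_mul] at h2 ⊢
    rw [inv_mul_le_iff₀ ht.1]
    nlinarith

lemma strongConvex_monotone {p : ℕ} {F : Vec p → ℝ} {μ : ℝ}
    (hF : StrongConvexOn Set.univ μ F) {gF : Vec p → Vec p} (hg : ∀ x, HasGradientAt F (gF x) x)
    (x y : Vec p) : μ * ‖x - y‖ ^ 2 ≤ inner ℝ (gF x - gF y) (x - y) := by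
  have h1 := strongConvex_first_order hF (hg x) y
  have h2 := strongConvex_first_order hF (hg y) x
  have h3 : inner ℝ (gF x) (y - x) = - inner ℝ (gF x) (x - y) := by
    rw [← inner_neg_right, neg_sub]
  rw [norm_sub_rev y x, h3] at h1
  rw [inner_sub_left]
  linarith

/-- The modulus of convexity is at most the Lipschitz constant of the gradient, provided that the
space is not a single point. -/
lemma le_lipschitz_of_monotone {p : ℕ} (hp : 0 < p) {μ ℓ : ℝ} {gF : Vec p → Vec p}
    (hmono : ∀ x y, μ * ‖x - y‖ ^ 2 ≤ inner ℝ (gF x - gF y) (x - y))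
    (hlip : ∀ x y, ‖gF x - gF y‖ ≤ ℓ * ‖x - y‖) : μ ≤ ℓ := by
  have : Nonempty (Fin p) := ⟨⟨0, hp⟩⟩
  obtain ⟨x, hx⟩ := exists_ne (0 : Vec p)
  have hx' : 0 < ‖x - 0‖ := by simpa using hx
  have h1 := hmono x 0
  have h2 := real_inner_le_norm (gF x - gF 0) (x - 0)
  have h3 := mul_le_mul_of_nonneg_right (hlip x 0) hx'.le
  have : μ * ‖x - 0‖ ^ 2 ≤ ℓ * ‖x - 0‖ ^ 2 := by nlinarith
  exact le_of_mul_le_mul_right this (by positivity)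

/-- A gradient step with a small step size is a contraction, so it has a fixed point. -/
lemma exists_zero_of_monotone {p : ℕ} {μ ℓ : ℝ} (hμ : 0 < μ) (hℓ : 0 < ℓ) {gF : Vec p → Vec p}
    (hmono : ∀ x y, μ * ‖x - y‖ ^ 2 ≤ inner ℝ (gF x - gF y) (x - y))
    (hlip : ∀ x y, ‖gF x - gF y‖ ≤ ℓ * ‖x - y‖) : ∃ x, gF x = 0 := by
  set η := μ / ℓ ^ 2 with hη
  have hη0 : 0 < η := by positivity
  set q := √(1 - η * μ) with hq
  have hstep : ∀ x y, ‖(x - η • gF x) - (y - η • gF y)‖ ^ 2 ≤ (1 - η * μ) * ‖x - y‖ ^ 2 := by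
    intro x y
    have e : (x - η • gF x) - (y - η • gF y) = (x - y) - η • (gF x - gF y) := by
      rw [smul_sub]; abel
    rw [e, norm_sub_sq_real, inner_smul_right, norm_smul, mul_pow, Real.norm_eq_abs, sq_abs,
      real_inner_comm]
    have h1 := mul_le_mul_of_nonneg_left (hmono x y) hη0.le
    have h2 : ‖gF x - gF y‖ ^ 2 ≤ ℓ ^ 2 * ‖x - y‖ ^ 2 := by
      rw [← mul_pow]; exact pow_le_pow_left₀ (norm_nonneg _) (hlip x y) 2
    have h3 := mul_le_mul_of_nonneg_left h2 (sq_nonneg η)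
    have h4 : η ^ 2 * (ℓ ^ 2 * ‖x - y‖ ^ 2) = η * μ * ‖x - y‖ ^ 2 := by
      rw [hη]; field_simp
    nlinarith
  have hq1 : q < 1 := by
    rw [hq, Real.sqrt_lt' one_pos]
    nlinarith [mul_pos hη0 hμ]
  have hcon : ContractingWith q.toNNReal (fun x => x - η • gF x) := by
    refine ⟨Real.toNNReal_lt_one.2 hq1, LipschitzWith.of_dist_le_mul fun x y => ?_⟩
    rw [dist_eq_norm, dist_eq_norm, Real.coe_toNNReal q (Real.sqrt_nonneg _)]
    rcases le_or_gt 0 (1 - η * μ) with h | h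
    · refine (pow_le_pow_iff_left₀ (norm_nonneg _) (by positivity) two_ne_zero).1 ?_
      rw [mul_pow, hq, Real.sq_sqrt h]
      exact hstep x y
    · have h5 := hstep x y
      have h6 : ‖(x - η • gF x) - (y - η • gF y)‖ ^ 2 ≤ 0 := by
        nlinarith [sq_nonneg ‖x - y‖]
      have h7 : ‖(x - η • gF x) - (y - η • gF y)‖ = 0 := by
        have := sq_nonneg ‖(x - η • gF x) - (y - η • gF y)‖
        exact pow_eq_zero_iff two_ne_zero |>.1 (le_antisymm h6 this)
      rw [h7]; positivity
  refine ⟨hcon.fixedPoint _, ?_⟩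
  have hfix : hcon.fixedPoint _ - η • gF (hcon.fixedPoint _) = hcon.fixedPoint _ :=
    hcon.fixedPoint_isFixedPt
  have : η • gF (hcon.fixedPoint _) = 0 := by simpa using hfix
  exact (smul_eq_zero.1 this).resolve_left hη0.ne'

/-- The gradient of the local cost, as an average of component gradients. -/
noncomputable def localGrad {n p : ℕ} {m : Fin n → ℕ} (f : (i : Fin n) → Fin (m i) → Vec p → ℝ)
    (i : Fin n) (x : Vec p) : Vec p :=
  (1 / (m i : ℝ)) • ∑ j, gradient (f i j) x

/-- The gradient of the global cost, as an average of local gradients. -/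
noncomputable def globalGrad {n p : ℕ} {m : Fin n → ℕ} (f : (i : Fin n) → Fin (m i) → Vec p → ℝ)
    (x : Vec p) : Vec p :=
  (1 / (n : ℝ)) • ∑ i, localGrad f i x

lemma HasGradientAt.const_mul_sum {p : ℕ} {ι : Type*} [Fintype ι] (a : ℝ) {h : ι → Vec p → ℝ}
    {g : ι → Vec p} {x : Vec p} (hg : ∀ i, HasGradientAt (h i) (g i) x) :
    HasGradientAt (fun y => a * ∑ i, h i y) (a • ∑ i, g i) x := by
  rw [hasGradientAt_iff_hasFDerivAt]
  have h1 := (HasFDerivAt.fun_sum (u := Finset.univ) fun i _ => (hg i).hasFDerivAt).const_mul a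
  simpa using h1

lemma hasGradientAt_globalCost {n p : ℕ} {m : Fin n → ℕ}
    {f : (i : Fin n) → Fin (m i) → Vec p → ℝ} (hf : ∀ i j, Differentiable ℝ (f i j))
    (x : Vec p) : HasGradientAt (globalCost f) (globalGrad f x) x :=
  HasGradientAt.const_mul_sum _ fun i =>
    HasGradientAt.const_mul_sum _ fun j => (hf i j x).hasGradientAt

lemma norm_average_le {V : Type*} [NormedAddCommGroup V] [NormedSpace ℝ V] {k : ℕ} (hk : 0 < k)
    {u : Fin k → V} {b : ℝ} (hu : ∀ j, ‖u j‖ ≤ b) : ‖(1 / (k : ℝ)) • ∑ j, u j‖ ≤ b := by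
  have hk' : (0 : ℝ) < k := by exact_mod_cast hk
  rw [norm_smul, Real.norm_of_nonneg (by positivity), one_div, inv_mul_le_iff₀ hk']
  calc ‖∑ j, u j‖ ≤ ∑ j, ‖u j‖ := norm_sum_le _ _
    _ ≤ ∑ _j : Fin k, b := Finset.sum_le_sum fun j _ => hu j
    _ = k * b := by simp

lemma localGrad_lipschitz {n p : ℕ} {m : Fin n → ℕ} (hm : ∀ i, 0 < m i)
    {f : (i : Fin n) → Fin (m i) → Vec p → ℝ} {ℓ : ℝ} (hf : ∀ i j, IsSmooth ℓ (f i j))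
    (i : Fin n) (x y : Vec p) : ‖localGrad f i x - localGrad f i y‖ ≤ ℓ * ‖x - y‖ := by
  rw [localGrad, localGrad, ← smul_sub, ← Finset.sum_sub_distrib]
  exact norm_average_le (hm i) fun j => (hf i j).2 x y

lemma globalGrad_lipschitz {n p : ℕ} (hn : 0 < n) {m : Fin n → ℕ} (hm : ∀ i, 0 < m i)
    {f : (i : Fin n) → Fin (m i) → Vec p → ℝ} {ℓ : ℝ} (hf : ∀ i j, IsSmooth ℓ (f i j))
    (x y : Vec p) : ‖globalGrad f x - globalGrad f y‖ ≤ ℓ * ‖x - y‖ := by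
  rw [globalGrad, globalGrad, ← smul_sub, ← Finset.sum_sub_distrib]
  exact norm_average_le hn fun i => localGrad_lipschitz hm hf i x y

/-! ### Errors and their one-step bounds -/

/-- Squared distance of the `π`-weighted mean of the iterates from `xstar`. -/
noncomputable def optErr {n p : ℕ} (π : Fin n → ℝ) (xstar : Vec p) (x : Fin n → Vec p) : ℝ :=
  ‖∑ r, π r • x r - xstar‖ ^ 2

/-- Weighted squared disagreement of the iterates. -/
noncomputable def consErr {n p : ℕ} (π : Fin n → ℝ) (x : Fin n → Vec p) : ℝ :=
  ∑ i, π i * ‖x i - ∑ r, π r • x r‖ ^ 2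

/-- Weighted squared distance of the trackers `w` from the multiple of `π` with the same sum. -/
noncomputable def trackErr {n p : ℕ} (π : Fin n → ℝ) (w : Fin n → Vec p) : ℝ :=
  ∑ i, (π i)⁻¹ * ‖w i - π i • ∑ r, w r‖ ^ 2

/-- Squared distance of gradient estimates from the local gradients at `xstar`. -/
noncomputable def gradErr {n p : ℕ} {m : Fin n → ℕ} (f : (i : Fin n) → Fin (m i) → Vec p → ℝ)
    (xstar : Vec p) (g : Fin n → Vec p) : ℝ :=
  ∑ i, ‖g i - localGrad f i xstar‖ ^ 2

/-- Mean squared distance of the table of node `i` from the component gradients at `xstar`. -/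
noncomputable def nodeTableErr {n p : ℕ} {m : Fin n → ℕ}
    (f : (i : Fin n) → Fin (m i) → Vec p → ℝ) (xstar : Vec p) (i : Fin n)
    (τ : Fin (m i) → Vec p) : ℝ :=
  (1 / (m i : ℝ)) * ∑ j, ‖τ j - gradient (f i j) xstar‖ ^ 2

/-- Sum over the nodes of the mean squared table errors. -/
noncomputable def tableErr {n p : ℕ} {m : Fin n → ℕ}
    (f : (i : Fin n) → Fin (m i) → Vec p → ℝ) (xstar : Vec p)
    (τ : (i : Fin n) → Fin (m i) → Vec p) : ℝ :=
  ∑ i, nodeTableErr f xstar i (τ i)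

lemma optErr_nonneg {n p : ℕ} (π : Fin n → ℝ) (xstar : Vec p) (x : Fin n → Vec p) :
    0 ≤ optErr π xstar x := sq_nonneg _

lemma consErr_nonneg {n p : ℕ} {π : Fin n → ℝ} (hπ : ∀ i, 0 < π i) (x : Fin n → Vec p) :
    0 ≤ consErr π x :=
  Finset.sum_nonneg fun i _ => mul_nonneg (hπ i).le (sq_nonneg _)

lemma trackErr_nonneg {n p : ℕ} {π : Fin n → ℝ} (hπ : ∀ i, 0 < π i) (w : Fin n → Vec p) :
    0 ≤ trackErr π w :=
  Finset.sum_nonneg fun i _ => mul_nonneg (inv_nonneg.2 (hπ i).le) (sq_nonneg _)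

lemma gradErr_nonneg {n p : ℕ} {m : Fin n → ℕ} (f : (i : Fin n) → Fin (m i) → Vec p → ℝ)
    (xstar : Vec p) (g : Fin n → Vec p) : 0 ≤ gradErr f xstar g :=
  Finset.sum_nonneg fun _ _ => sq_nonneg _

lemma nodeTableErr_nonneg {n p : ℕ} {m : Fin n → ℕ} (f : (i : Fin n) → Fin (m i) → Vec p → ℝ)
    (xstar : Vec p) (i : Fin n) (τ : Fin (m i) → Vec p) : 0 ≤ nodeTableErr f xstar i τ :=
  mul_nonneg (by positivity) (Finset.sum_nonneg fun j _ => sq_nonneg _)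

lemma tableErr_nonneg {n p : ℕ} {m : Fin n → ℕ} (f : (i : Fin n) → Fin (m i) → Vec p → ℝ)
    (xstar : Vec p) (τ : (i : Fin n) → Fin (m i) → Vec p) : 0 ≤ tableErr f xstar τ :=
  Finset.sum_nonneg fun i _ => nodeTableErr_nonneg f xstar i (τ i)

/-- The iterates deviate from `xstar` by the optimality error and the disagreement. -/
lemma sum_norm_sub_sq_le {n p : ℕ} {π : Fin n → ℝ} {rmin : ℝ}
    (hr : 0 < rmin) (hrmin : ∀ i, rmin ≤ π i) (xstar : Vec p) (x : Fin n → Vec p) :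
    ∑ i, ‖x i - ∑ r, π r • x r‖ ^ 2 ≤ consErr π x / rmin ∧
    ∑ i, ‖x i - xstar‖ ^ 2 ≤ 2 * n * optErr π xstar x + 2 * (consErr π x / rmin) := by
  have h1 : ∑ i, ‖x i - ∑ r, π r • x r‖ ^ 2 ≤ consErr π x / rmin := by
    rw [le_div_iff₀ hr, Finset.sum_mul]
    refine Finset.sum_le_sum fun i _ => ?_
    rw [mul_comm]
    exact mul_le_mul_of_nonneg_right (hrmin i) (sq_nonneg _)
  refine ⟨h1, ?_⟩
  have h2 : ∀ i, ‖x i - xstar‖ ^ 2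
      ≤ 2 * ‖x i - ∑ r, π r • x r‖ ^ 2 + 2 * optErr π xstar x := fun i => by
    have e : x i - xstar = (x i - ∑ r, π r • x r) + (∑ r, π r • x r - xstar) := by abel
    rw [e]
    exact norm_add_sq_le_two _ _
  calc ∑ i, ‖x i - xstar‖ ^ 2
      ≤ ∑ i, (2 * ‖x i - ∑ r, π r • x r‖ ^ 2 + 2 * optErr π xstar x) :=
        Finset.sum_le_sum fun i _ => h2 i
    _ = 2 * n * optErr π xstar x + 2 * ∑ i, ‖x i - ∑ r, π r • x r‖ ^ 2 := by
        rw [Finset.sum_add_distrib, ← Finset.mul_sum]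
        simp only [Finset.sum_const, Finset.card_univ, Fintype.card_fin, nsmul_eq_mul]
        ring
    _ ≤ _ := by linarith

lemma ColPair.trackErr_le {n p : ℕ} {m : Fin n → ℕ} {f : (i : Fin n) → Fin (m i) → Vec p → ℝ}
    {B : Matrix (Fin n) (Fin n) ℝ} {π : Fin n → ℝ} (h : ColPair B π) {cmin : ℝ} (hc : 0 < cmin)
    (hcmin : ∀ i, cmin ≤ π i) (d : ℕ) (xstar : Vec p) (w g g' : Fin n → Vec p) :
    trackErr π (fun i => ∑ r, (B ^ d) i r • (w r + g' r - g r))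
      ≤ (sigmaCol B π ^ d) ^ 2 * (2 * trackErr π w
        + 4 / cmin * (gradErr f xstar g + gradErr f xstar g')) := by
  unfold trackErr
  rw [h.sum_pow]
  refine (h.sum_norm_pow_sq_le d fun r => w r + g' r - g r).trans ?_
  refine mul_le_mul_of_nonneg_left ?_ (sq_nonneg _)
  have hπ : ∀ i, π i ≠ 0 := fun i => (h.pos i).ne'
  -- the weighted variance is at most the second moment about `∑ r, w r`
  have hvar : ∑ i, (π i)⁻¹ * ‖w i + g' i - g i - π i • ∑ r, (w r + g' r - g r)‖ ^ 2
      ≤ ∑ i, (π i)⁻¹ * ‖w i + g' i - g i - π i • ∑ r, w r‖ ^ 2 := by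
    have h1 := sum_mul_norm_sub_mean_le h.sum_one
      (fun i => (π i)⁻¹ • (w i + g' i - g i)) (∑ r, w r)
    have hm : ∑ r, π r • (π r)⁻¹ • (w r + g' r - g r) = ∑ r, (w r + g' r - g r) :=
      Finset.sum_congr rfl fun r _ => by rw [smul_smul, mul_inv_cancel₀ (hπ r), one_smul]
    have hscale : ∀ i, ∀ u v : Vec p,
        π i * ‖(π i)⁻¹ • u - v‖ ^ 2 = (π i)⁻¹ * ‖u - π i • v‖ ^ 2 := by
      intro i u v
      have e : u - π i • v = π i • ((π i)⁻¹ • u - v) := by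
        rw [smul_sub, smul_smul, mul_inv_cancel₀ (hπ i), one_smul]
      rw [e, norm_smul, mul_pow, Real.norm_eq_abs, sq_abs]
      have := hπ i
      field_simp
    rw [hm] at h1
    simp_rw [hscale] at h1
    exact h1
  refine hvar.trans ?_
  have hterm : ∀ i, (π i)⁻¹ * ‖w i + g' i - g i - π i • ∑ r, w r‖ ^ 2
      ≤ 2 * ((π i)⁻¹ * ‖w i - π i • ∑ r, w r‖ ^ 2)
        + 4 / cmin * (‖g i - localGrad f i xstar‖ ^ 2 + ‖g' i - localGrad f i xstar‖ ^ 2) := by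
    intro i
    have e : w i + g' i - g i - π i • ∑ r, w r = (w i - π i • ∑ r, w r) + (g' i - g i) := by abel
    have e' : g' i - g i = (g' i - localGrad f i xstar) - (g i - localGrad f i xstar) := by abel
    have h1 := norm_add_sq_le_two (w i - π i • ∑ r, w r) (g' i - g i)
    have h2 := norm_sub_sq_le_two (g' i - localGrad f i xstar) (g i - localGrad f i xstar)
    rw [← e'] at h2
    rw [e]
    have hinv : (π i)⁻¹ ≤ cmin⁻¹ := inv_anti₀ hc (hcmin i)
    have hinv0 : 0 ≤ (π i)⁻¹ := inv_nonneg.2 (h.pos i).le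
    have h3 := mul_le_mul_of_nonneg_left h1 hinv0
    have h4 : (π i)⁻¹ * (2 * ‖g' i - g i‖ ^ 2) ≤ cmin⁻¹ * (2 * (2 * ‖g' i - localGrad f i xstar‖ ^ 2
        + 2 * ‖g i - localGrad f i xstar‖ ^ 2)) :=
      mul_le_mul hinv (by linarith) (by positivity) (by positivity)
    rw [div_eq_mul_inv]
    linarith
  refine (Finset.sum_le_sum fun i _ => hterm i).trans (le_of_eq ?_)
  rw [Finset.sum_add_distrib, ← Finset.mul_sum, ← Finset.mul_sum, Finset.sum_add_distrib]
  rfl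

/-- Cauchy-Schwarz for the part of the mean update that is due to inexact tracking. -/
lemma norm_sum_track_sq_le {n p : ℕ} {πr πc : Fin n → ℝ} (hr : ∀ i, 0 < πr i)
    (hc : ∀ i, 0 < πc i) {rmax : ℝ} (hrmax : ∀ i, πr i ≤ rmax) (w : Fin n → Vec p) :
    ‖∑ i, πr i • (w i - πc i • ∑ r, w r)‖ ^ 2
      ≤ rmax * dotProduct πr πc * trackErr πc w := by
  set e : Fin n → Vec p := fun i => w i - πc i • ∑ r, w r with he
  have h1 : ‖∑ i, πr i • e i‖ ≤ ∑ i, (πr i * √(πc i)) * ((√(πc i))⁻¹ * ‖e i‖) := by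
    refine (norm_sum_le _ _).trans (le_of_eq (Finset.sum_congr rfl fun i _ => ?_))
    rw [norm_smul, Real.norm_of_nonneg (hr i).le]
    have := (Real.sqrt_pos.2 (hc i)).ne'
    field_simp
  have h2 := Finset.sum_mul_sq_le_sq_mul_sq Finset.univ (fun i => πr i * √(πc i))
    (fun i => (√(πc i))⁻¹ * ‖e i‖)
  have h3 : ∑ i, (πr i * √(πc i)) ^ 2 ≤ rmax * dotProduct πr πc := by
    rw [dotProduct, Finset.mul_sum]
    refine Finset.sum_le_sum fun i _ => ?_
    rw [mul_pow, Real.sq_sqrt (hc i).le, sq, mul_assoc]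
    exact mul_le_mul_of_nonneg_right (hrmax i) (mul_nonneg (hr i).le (hc i).le)
  have h4 : ∑ i, ((√(πc i))⁻¹ * ‖e i‖) ^ 2 = trackErr πc w := by
    refine Finset.sum_congr rfl fun i _ => ?_
    rw [mul_pow, inv_pow, Real.sq_sqrt (hc i).le]
  calc _ ≤ (∑ i, (πr i * √(πc i)) * ((√(πc i))⁻¹ * ‖e i‖)) ^ 2 := by gcongr
    _ ≤ _ := h2
    _ ≤ _ := by
      rw [h4]
      exact mul_le_mul_of_nonneg_right h3 (trackErr_nonneg hc w)

lemma sum_mul_norm_sq_le {n p : ℕ} {πr πc : Fin n → ℝ} (hr : ∀ i, 0 < πr i)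
    (hc : ∀ i, 0 < πc i) {rmax cmax : ℝ} (hrmax : ∀ i, πr i ≤ rmax) (hcmax : ∀ i, πc i ≤ cmax)
    (w : Fin n → Vec p) :
    ∑ i, πr i * ‖w i‖ ^ 2
      ≤ 2 * (rmax * cmax * trackErr πc w) + 2 * (cmax * dotProduct πr πc * ‖∑ r, w r‖ ^ 2) := by
  have hterm : ∀ i, πr i * ‖w i‖ ^ 2
      ≤ 2 * (rmax * cmax * ((πc i)⁻¹ * ‖w i - πc i • ∑ r, w r‖ ^ 2))
        + 2 * (cmax * (πr i * πc i) * ‖∑ r, w r‖ ^ 2) := by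
    intro i
    have h1 := norm_add_sq_le_two (w i - πc i • ∑ r, w r) (πc i • ∑ r, w r)
    rw [sub_add_cancel, norm_smul, mul_pow, Real.norm_eq_abs, sq_abs] at h1
    have h2 := mul_le_mul_of_nonneg_left h1 (hr i).le
    have h3 : πr i ≤ rmax * cmax * (πc i)⁻¹ := by
      rw [← div_eq_mul_inv, le_div_iff₀ (hc i)]
      exact mul_le_mul (hrmax i) (hcmax i) (hc i).le ((hr i).le.trans (hrmax i))
    have h4 := mul_le_mul_of_nonneg_right h3 (sq_nonneg ‖w i - πc i • ∑ r, w r‖)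
    have h5 : πr i * πc i ^ 2 ≤ cmax * (πr i * πc i) := by
      have := mul_le_mul_of_nonneg_right (hcmax i) (mul_nonneg (hr i).le (hc i).le)
      linarith
    have h6 := mul_le_mul_of_nonneg_right h5 (sq_nonneg ‖∑ r, w r‖)
    linarith
  refine (Finset.sum_le_sum fun i _ => hterm i).trans (le_of_eq ?_)
  rw [Finset.sum_add_distrib, ← Finset.mul_sum, ← Finset.mul_sum, ← Finset.mul_sum,
    ← Finset.sum_mul, ← Finset.mul_sum]
  rfl

lemma RowPair.consErr_le {n p : ℕ} {A : Matrix (Fin n) (Fin n) ℝ} {π : Fin n → ℝ}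
    (h : RowPair A π) (c : ℕ) (α : ℝ) (x w : Fin n → Vec p) :
    consErr π (fun i => ∑ r, (A ^ c) i r • (x r - α • w r))
      ≤ (sigmaRow A π ^ c) ^ 2 * (2 * consErr π x + 2 * α ^ 2 * ∑ i, π i * ‖w i‖ ^ 2) := by
  unfold consErr
  rw [h.sum_pow]
  refine (h.sum_norm_pow_sq_le c fun r => x r - α • w r).trans ?_
  refine mul_le_mul_of_nonneg_left ?_ (sq_nonneg _)
  refine (sum_mul_norm_sub_mean_le h.sum_one (fun r => x r - α • w r)
    (∑ r, π r • x r)).trans ?_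
  rw [Finset.mul_sum, Finset.mul_sum, ← Finset.sum_add_distrib]
  refine Finset.sum_le_sum fun i _ => ?_
  have e : x i - α • w i - ∑ r, π r • x r = (x i - ∑ r, π r • x r) - α • w i := by abel
  have h1 := norm_sub_sq_le_two (x i - ∑ r, π r • x r) (α • w i)
  rw [norm_smul, mul_pow, Real.norm_eq_abs, sq_abs, ← e] at h1
  linarith [mul_le_mul_of_nonneg_left h1 (h.pos i).le]

lemma norm_sub_sq_le_young {V : Type*} [NormedAddCommGroup V] {ζ : ℝ} (hζ : 0 < ζ) (a b : V) :
    ‖a - b‖ ^ 2 ≤ (1 + ζ) * ‖a‖ ^ 2 + (1 + 1 / ζ) * ‖b‖ ^ 2 := by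
  have h1 := norm_sub_le a b
  have h2 : ‖a - b‖ ^ 2 ≤ (‖a‖ + ‖b‖) ^ 2 := by gcongr
  have h3 : 0 ≤ 1 / ζ * (ζ * ‖a‖ - ‖b‖) ^ 2 := by positivity
  have h4 : 1 / ζ * (ζ * ‖a‖ - ‖b‖) ^ 2
      = ζ * ‖a‖ ^ 2 + 1 / ζ * ‖b‖ ^ 2 - 2 * (‖a‖ * ‖b‖) := by field_simp; ring
  linarith

lemma RowPair.optErr_le {n p : ℕ} {A : Matrix (Fin n) (Fin n) ℝ} {πr πc : Fin n → ℝ}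
    (h : RowPair A πr) (hc : ∀ i, 0 < πc i) {rmax : ℝ} (hrmax : ∀ i, πr i ≤ rmax) (c : ℕ) (α : ℝ)
    (xstar : Vec p) (x w : Fin n → Vec p) {ζ : ℝ} (hζ : 0 < ζ) :
    optErr πr xstar (fun i => ∑ r, (A ^ c) i r • (x r - α • w r))
      ≤ (1 + ζ) * ‖(∑ r, πr r • x r - xstar) - (α * dotProduct πr πc) • ∑ r, w r‖ ^ 2
        + (1 + 1 / ζ) * (α ^ 2 * (rmax * dotProduct πr πc * trackErr πc w)) := by
  unfold optErr
  rw [h.sum_pow]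
  have e : ∑ r, πr r • (x r - α • w r) - xstar
      = ((∑ r, πr r • x r - xstar) - (α * dotProduct πr πc) • ∑ r, w r)
        - α • ∑ i, πr i • (w i - πc i • ∑ r, w r) := by
    simp_rw [smul_sub, Finset.sum_sub_distrib, smul_smul, ← Finset.sum_smul, smul_sub, smul_smul]
    simp_rw [mul_comm _ α, ← smul_smul, ← Finset.smul_sum]
    rw [dotProduct]
    abel
  rw [e]
  refine (norm_sub_sq_le_young hζ _ _).trans ?_
  rw [norm_smul, mul_pow, Real.norm_eq_abs, sq_abs]
  have h1 := norm_sum_track_sq_le h.pos hc hrmax w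
  gcongr

/-! ### Averages over one draw of indices -/

/-- Nonnegative weights on the index tuples whose marginals are uniform. -/
structure UniformWeights {n : ℕ} (m : Fin n → ℕ) (q : ((i : Fin n) → Fin (m i)) → ℝ) : Prop where
  nonneg : ∀ s, 0 ≤ q s
  marginal : ∀ i j, ∑ s, (if s i = j then q s else 0) = 1 / (m i : ℝ)

lemma UniformWeights.sum_smul {n : ℕ} {m : Fin n → ℕ} {q : ((i : Fin n) → Fin (m i)) → ℝ}
    (hq : UniformWeights m q) {V : Type*} [AddCommGroup V] [Module ℝ V] (i : Fin n)
    (φ : Fin (m i) → V) : ∑ s, q s • φ (s i) = (1 / (m i : ℝ)) • ∑ j, φ j := by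
  have h1 : ∀ s : (i : Fin n) → Fin (m i),
      q s • φ (s i) = ∑ j, (if s i = j then q s else 0) • φ j := by
    intro s
    rw [Finset.sum_eq_single (s i)]
    · simp
    · intro j _ hj; rw [if_neg hj.symm, zero_smul]
    · simp
  simp_rw [h1]
  rw [Finset.sum_comm, Finset.smul_sum]
  refine Finset.sum_congr rfl fun j _ => ?_
  rw [← Finset.sum_smul, hq.marginal]

lemma UniformWeights.sum_mul {n : ℕ} {m : Fin n → ℕ} {q : ((i : Fin n) → Fin (m i)) → ℝ}
    (hq : UniformWeights m q) (i : Fin n) (φ : Fin (m i) → ℝ) :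
    ∑ s, q s * φ (s i) = (1 / (m i : ℝ)) * ∑ j, φ j := by
  simpa using hq.sum_smul i φ

lemma UniformWeights.sum_one {n : ℕ} {m : Fin n → ℕ} {q : ((i : Fin n) → Fin (m i)) → ℝ}
    (hq : UniformWeights m q) (hn : 0 < n) (hm : ∀ i, 0 < m i) : ∑ s, q s = 1 := by
  have h1 := hq.sum_mul ⟨0, hn⟩ (fun _ => 1)
  have h2 : (m ⟨0, hn⟩ : ℝ) ≠ 0 := by exact_mod_cast (hm _).ne'
  simpa [h2] using h1

/-- The SAGA estimate of node `i` at the point `x` with table `τ` and drawn index `j`. -/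
noncomputable def sagaEst {n p : ℕ} {m : Fin n → ℕ} (f : (i : Fin n) → Fin (m i) → Vec p → ℝ)
    (i : Fin n) (x : Vec p) (τ : Fin (m i) → Vec p) (j : Fin (m i)) : Vec p :=
  gradient (f i j) x - τ j + (1 / (m i : ℝ)) • ∑ j, τ j

lemma sum_uniform_one {k : ℕ} (hk : 0 < k) : ∑ _j : Fin k, (1 / (k : ℝ)) = 1 := by
  have : (k : ℝ) ≠ 0 := by exact_mod_cast hk.ne'
  simp [this]

lemma sagaEst_mean {n p : ℕ} {m : Fin n → ℕ} (hm : ∀ i, 0 < m i)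
    (f : (i : Fin n) → Fin (m i) → Vec p → ℝ) (i : Fin n) (x : Vec p) (τ : Fin (m i) → Vec p) :
    (1 / (m i : ℝ)) • ∑ j, sagaEst f i x τ j = localGrad f i x := by
  have h : (m i : ℝ) ≠ 0 := by exact_mod_cast (hm i).ne'
  have h1 : ∑ _j : Fin (m i), (1 / (m i : ℝ)) • ∑ j, τ j = ∑ j, τ j := by
    rw [← Finset.sum_smul, sum_uniform_one (hm i), one_smul]
  simp only [sagaEst, Finset.sum_add_distrib, Finset.sum_sub_distrib, h1, sub_add_cancel,
    localGrad]

/-- The error of the estimate is a gradient difference minus a centered table error, whose second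
moment is at most that of the table error itself. -/
lemma sagaEst_second_moment {n p : ℕ} {m : Fin n → ℕ} (hm : ∀ i, 0 < m i)
    {f : (i : Fin n) → Fin (m i) → Vec p → ℝ} {ℓ : ℝ} (hf : ∀ i j, IsSmooth ℓ (f i j))
    (xstar : Vec p) (i : Fin n) (x : Vec p) (τ : Fin (m i) → Vec p) :
    (1 / (m i : ℝ)) * ∑ j, ‖sagaEst f i x τ j - localGrad f i xstar‖ ^ 2
      ≤ 2 * ℓ ^ 2 * ‖x - xstar‖ ^ 2 + 2 * nodeTableErr f xstar i τ := by
  have h : (0 : ℝ) < m i := by exact_mod_cast hm i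
  set ξ : Fin (m i) → Vec p := fun j => τ j - gradient (f i j) xstar with hξ
  set b := ∑ j, (1 / (m i : ℝ)) • ξ j with hb
  have hbe : b = (1 / (m i : ℝ)) • ∑ j, τ j - localGrad f i xstar := by
    rw [hb, ← Finset.smul_sum, localGrad, ← smul_sub, ← Finset.sum_sub_distrib]
  have hterm : ∀ j, ‖sagaEst f i x τ j - localGrad f i xstar‖ ^ 2
      ≤ 2 * ℓ ^ 2 * ‖x - xstar‖ ^ 2 + 2 * ‖ξ j - b‖ ^ 2 := by
    intro j
    have e : sagaEst f i x τ j - localGrad f i xstar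
        = (gradient (f i j) x - gradient (f i j) xstar) - (ξ j - b) := by
      rw [hbe, sagaEst]; simp only [hξ]; abel
    have h1 := norm_sub_sq_le_two (gradient (f i j) x - gradient (f i j) xstar) (ξ j - b)
    have h2 : ‖gradient (f i j) x - gradient (f i j) xstar‖ ^ 2 ≤ (ℓ * ‖x - xstar‖) ^ 2 :=
      pow_le_pow_left₀ (norm_nonneg _) ((hf i j).2 x xstar) 2
    rw [e]
    linarith [mul_pow ℓ ‖x - xstar‖ 2]
  have hvar := sum_mul_norm_sub_mean_le (sum_uniform_one (hm i)) ξ 0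
  simp only [sub_zero, ← Finset.mul_sum] at hvar
  have hsum := Finset.sum_le_sum fun j (_ : j ∈ Finset.univ) => hterm j
  rw [Finset.sum_add_distrib, ← Finset.mul_sum Finset.univ fun j => ‖ξ j - b‖ ^ 2] at hsum
  have h3 := mul_le_mul_of_nonneg_left hsum (show 0 ≤ 1 / (m i : ℝ) by positivity)
  have h4 : (1 / (m i : ℝ)) * ∑ _j : Fin (m i), 2 * ℓ ^ 2 * ‖x - xstar‖ ^ 2
      = 2 * ℓ ^ 2 * ‖x - xstar‖ ^ 2 := by
    rw [Finset.sum_const, Finset.card_univ, Fintype.card_fin, nsmul_eq_mul]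
    field_simp
  rw [mul_add, h4] at h3
  unfold nodeTableErr
  rw [← Finset.smul_sum] at hb
  rw [← Finset.smul_sum, ← hb] at hvar
  linarith

lemma UniformWeights.gradErr_le {n p : ℕ} {m : Fin n → ℕ} {q : ((i : Fin n) → Fin (m i)) → ℝ}
    (hq : UniformWeights m q) (hm : ∀ i, 0 < m i)
    {f : (i : Fin n) → Fin (m i) → Vec p → ℝ} {ℓ : ℝ} (hf : ∀ i j, IsSmooth ℓ (f i j))
    (xstar : Vec p) (x : Fin n → Vec p) (τ : (i : Fin n) → Fin (m i) → Vec p) :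
    ∑ s, q s * gradErr f xstar (fun i => sagaEst f i (x i) (τ i) (s i))
      ≤ 2 * ℓ ^ 2 * ∑ i, ‖x i - xstar‖ ^ 2 + 2 * tableErr f xstar τ := by
  unfold gradErr tableErr
  simp_rw [Finset.mul_sum]
  rw [Finset.sum_comm, ← Finset.sum_add_distrib]
  refine Finset.sum_le_sum fun i _ => ?_
  rw [hq.sum_mul i fun j => ‖sagaEst f i (x i) (τ i) j - localGrad f i xstar‖ ^ 2]
  exact sagaEst_second_moment hm hf xstar i (x i) (τ i)

lemma UniformWeights.tableErr_le {n p : ℕ} {m : Fin n → ℕ}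
    {q : ((i : Fin n) → Fin (m i)) → ℝ} (hq : UniformWeights m q)
    (hm : ∀ i, 0 < m i) {mmin mmax : ℝ} (hmin0 : 0 < mmin) (hmin : ∀ i, mmin ≤ m i)
    (hmax : ∀ i, (m i : ℝ) ≤ mmax)
    {f : (i : Fin n) → Fin (m i) → Vec p → ℝ} {ℓ : ℝ} (hf : ∀ i j, IsSmooth ℓ (f i j))
    (xstar : Vec p) (x : Fin n → Vec p) (τ : (i : Fin n) → Fin (m i) → Vec p) :
    ∑ s, q s * tableErr f xstar
        (fun i => Function.update (τ i) (s i) (gradient (f i (s i)) (x i)))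
      ≤ (1 - 1 / mmax) * tableErr f xstar τ + ℓ ^ 2 / mmin * ∑ i, ‖x i - xstar‖ ^ 2 := by
  unfold tableErr
  simp_rw [Finset.mul_sum]
  rw [Finset.sum_comm, ← Finset.sum_add_distrib]
  refine Finset.sum_le_sum fun i _ => ?_
  have h : (0 : ℝ) < m i := by exact_mod_cast hm i
  set t := nodeTableErr f xstar i (τ i) with ht
  have ht0 : 0 ≤ t := nodeTableErr_nonneg f xstar i (τ i)
  have hupd : ∀ j, nodeTableErr f xstar i
      (Function.update (τ i) j (gradient (f i j) (x i)))
      = t + (1 / (m i : ℝ)) * (‖gradient (f i j) (x i) - gradient (f i j) xstar‖ ^ 2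
        - ‖τ i j - gradient (f i j) xstar‖ ^ 2) := by
    intro j
    rw [ht, nodeTableErr, nodeTableErr, ← mul_add]
    congr 1
    rw [← Finset.add_sum_erase _ _ (Finset.mem_univ j),
      ← Finset.add_sum_erase Finset.univ (fun j => ‖τ i j - gradient (f i j) xstar‖ ^ 2)
        (Finset.mem_univ j), Function.update_self]
    rw [Finset.sum_congr rfl fun k hk => by
      rw [Function.update_of_ne (Finset.ne_of_mem_erase hk)]]
    ring
  rw [hq.sum_mul i fun j => nodeTableErr f xstar i
      (Function.update (τ i) j (gradient (f i j) (x i)))]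
  simp_rw [hupd]
  rw [Finset.sum_add_distrib, ← Finset.mul_sum, Finset.sum_sub_distrib]
  have e1 : ∑ j, ‖τ i j - gradient (f i j) xstar‖ ^ 2 = m i * t := by
    rw [ht, nodeTableErr]; field_simp
  have e2 : ∑ j, ‖gradient (f i j) (x i) - gradient (f i j) xstar‖ ^ 2
      ≤ m i * (ℓ ^ 2 * ‖x i - xstar‖ ^ 2) := by
    calc _ ≤ ∑ _j : Fin (m i), ℓ ^ 2 * ‖x i - xstar‖ ^ 2 := by
          refine Finset.sum_le_sum fun j _ => ?_
          rw [← mul_pow]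
          exact pow_le_pow_left₀ (norm_nonneg _) ((hf i j).2 _ _) 2
      _ = _ := by simp
  have e3 : (1 / (m i : ℝ)) * (1 / (m i : ℝ) *
      (∑ j, ‖gradient (f i j) (x i) - gradient (f i j) xstar‖ ^ 2))
      ≤ 1 / (m i : ℝ) * (ℓ ^ 2 * ‖x i - xstar‖ ^ 2) := by
    refine mul_le_mul_of_nonneg_left ?_ (by positivity)
    rw [one_div, inv_mul_le_iff₀ h]
    exact e2
  have e4 : 1 / (m i : ℝ) ≤ 1 / mmin := one_div_le_one_div_of_le hmin0 (hmin i)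
  have e5 : 1 / mmax ≤ 1 / (m i : ℝ) := one_div_le_one_div_of_le h (hmax i)
  have e6 := mul_le_mul_of_nonneg_right e4 (show 0 ≤ ℓ ^ 2 * ‖x i - xstar‖ ^ 2 by positivity)
  have e7 := mul_le_mul_of_nonneg_right e5 ht0
  have e8 : (1 / (m i : ℝ)) * ∑ _j : Fin (m i), t = t := by
    rw [Finset.sum_const, Finset.card_univ, Fintype.card_fin, nsmul_eq_mul]; field_simp
  have e9 : (1 / (m i : ℝ)) * (1 / (m i : ℝ) * (m i * t)) = 1 / (m i : ℝ) * t := by field_simp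
  have e10 : ℓ ^ 2 / mmin * ‖x i - xstar‖ ^ 2 = 1 / mmin * (ℓ ^ 2 * ‖x i - xstar‖ ^ 2) := by ring
  rw [e1, mul_add, e8, mul_sub, mul_sub, e9, e10]
  linarith

/-- Descent of the mean iterate along the summed estimates, in expectation. -/
lemma UniformWeights.descent {n p : ℕ} {m : Fin n → ℕ}
    {q : ((i : Fin n) → Fin (m i)) → ℝ} (hq : UniformWeights m q) (hn : 0 < n)
    (hm : ∀ i, 0 < m i) {f : (i : Fin n) → Fin (m i) → Vec p → ℝ} {μ ℓ : ℝ} (hμ : 0 < μ)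
    (hf : ∀ i j, IsSmooth ℓ (f i j))
    (hmono : ∀ x y, μ * ‖x - y‖ ^ 2 ≤ inner ℝ (globalGrad f x - globalGrad f y) (x - y))
    {xstar : Vec p} (hstar : globalGrad f xstar = 0) {β : ℝ} (hβ : 0 ≤ β) (b : Vec p)
    (x : Fin n → Vec p) (τ : (i : Fin n) → Fin (m i) → Vec p) :
    ∑ s, q s * ‖(b - xstar) - β • ∑ i, sagaEst f i (x i) (τ i) (s i)‖ ^ 2
      ≤ (1 - 3 / 2 * (β * n * μ)) * ‖b - xstar‖ ^ 2
        + 2 * β * ℓ ^ 2 / μ * ∑ i, ‖x i - b‖ ^ 2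
        + β ^ 2 * (n * (2 * ℓ ^ 2 * ∑ i, ‖x i - xstar‖ ^ 2 + 2 * tableErr f xstar τ)) := by
  have hn' : (0 : ℝ) < n := by exact_mod_cast hn
  set a := b - xstar with ha
  set E := ∑ i, localGrad f i (x i) with hE
  have hstar' : ∑ i, localGrad f i xstar = 0 := by
    have := smul_eq_zero.1 hstar
    exact this.resolve_left (by positivity)
  have hexpand : ∀ s : (i : Fin n) → Fin (m i),
      q s * ‖a - β • ∑ i, sagaEst f i (x i) (τ i) (s i)‖ ^ 2
      ≤ q s * ‖a‖ ^ 2 - 2 * β * inner ℝ a (q s • ∑ i, sagaEst f i (x i) (τ i) (s i))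
        + β ^ 2 * (n * (q s * gradErr f xstar fun i => sagaEst f i (x i) (τ i) (s i))) := by
    intro s
    set S := ∑ i, sagaEst f i (x i) (τ i) (s i) with hS
    have hS2 : ‖S‖ ^ 2 ≤ n * gradErr f xstar fun i => sagaEst f i (x i) (τ i) (s i) := by
      have h1 := norm_sum_sq_le fun i => sagaEst f i (x i) (τ i) (s i) - localGrad f i xstar
      rw [Finset.sum_sub_distrib, hstar', sub_zero, Fintype.card_fin] at h1
      exact h1
    rw [norm_sub_sq_real, inner_smul_right, norm_smul, mul_pow, Real.norm_eq_abs, sq_abs,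
      inner_smul_right]
    have h2 := mul_le_mul_of_nonneg_left hS2 (mul_nonneg (hq.nonneg s) (sq_nonneg β))
    linarith
  have hmean : ∑ s, q s • ∑ i, sagaEst f i (x i) (τ i) (s i) = E := by
    simp_rw [Finset.smul_sum]
    rw [Finset.sum_comm]
    refine Finset.sum_congr rfl fun i _ => ?_
    rw [hq.sum_smul i fun j => sagaEst f i (x i) (τ i) j, sagaEst_mean hm]
  have hsum := Finset.sum_le_sum fun s (_ : s ∈ Finset.univ) => hexpand s
  rw [Finset.sum_add_distrib, Finset.sum_sub_distrib, ← Finset.sum_mul, hq.sum_one hn hm,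
    one_mul, ← Finset.mul_sum, ← inner_sum, hmean, ← Finset.mul_sum, ← Finset.mul_sum] at hsum
  refine hsum.trans ?_
  have hG := hq.gradErr_le hm hf xstar x τ
  have hG2 := mul_le_mul_of_nonneg_left hG (show 0 ≤ β ^ 2 * n by positivity)
  -- the mean direction is `n ∇F(b)` up to the disagreement
  set R := ∑ i, (localGrad f i (x i) - localGrad f i b) with hR
  have hER : E = (n : ℝ) • globalGrad f b + R := by
    rw [hR, Finset.sum_sub_distrib, globalGrad, smul_smul, mul_one_div_cancel hn'.ne', one_smul]
    abel
  have hR2 : ‖R‖ ^ 2 ≤ n * (ℓ ^ 2 * ∑ i, ‖x i - b‖ ^ 2) := by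
    have h1 := norm_sum_sq_le fun i => localGrad f i (x i) - localGrad f i b
    rw [Fintype.card_fin] at h1
    refine h1.trans (mul_le_mul_of_nonneg_left ?_ hn'.le)
    rw [Finset.mul_sum]
    refine Finset.sum_le_sum fun i _ => ?_
    rw [← mul_pow]
    exact pow_le_pow_left₀ (norm_nonneg _) (localGrad_lipschitz hm hf i _ _) 2
  have hin : μ * ‖a‖ ^ 2 ≤ inner ℝ a (globalGrad f b) := by
    have := hmono b xstar
    rwa [hstar, sub_zero, real_inner_comm] at this
  have hinR : - inner ℝ a R ≤ n * μ / 4 * ‖a‖ ^ 2 + ℓ ^ 2 / μ * ∑ i, ‖x i - b‖ ^ 2 := by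
    have h1 : -inner ℝ a R ≤ ‖a‖ * ‖R‖ := by
      have := abs_real_inner_le_norm a R
      linarith [neg_le_abs (inner ℝ a R)]
    have h2 : 0 ≤ 1 / (n * μ) * (n * μ / 2 * ‖a‖ - ‖R‖) ^ 2 := by positivity
    have h3 : 1 / (n * μ) * (n * μ / 2 * ‖a‖ - ‖R‖) ^ 2
        = n * μ / 4 * ‖a‖ ^ 2 + 1 / (n * μ) * ‖R‖ ^ 2 - ‖a‖ * ‖R‖ := by field_simp; ring
    have h4 := mul_le_mul_of_nonneg_left hR2 (show 0 ≤ 1 / (n * μ) by positivity)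
    have h5 : 1 / (n * μ) * (n * (ℓ ^ 2 * ∑ i, ‖x i - b‖ ^ 2))
        = ℓ ^ 2 / μ * ∑ i, ‖x i - b‖ ^ 2 := by field_simp
    linarith
  have hfin : - (2 * β * inner ℝ a E) ≤ - (3 / 2 * (β * n * μ)) * ‖a‖ ^ 2
      + 2 * β * ℓ ^ 2 / μ * ∑ i, ‖x i - b‖ ^ 2 := by
    rw [hER, inner_add_right, inner_smul_right]
    have h1 := mul_le_mul_of_nonneg_left hin (show 0 ≤ 2 * β * n by positivity)
    have h2 := mul_le_mul_of_nonneg_left hinR (show 0 ≤ 2 * β by positivity)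
    have h3 : 2 * β * (ℓ ^ 2 / μ * ∑ i, ‖x i - b‖ ^ 2)
        = 2 * β * ℓ ^ 2 / μ * ∑ i, ‖x i - b‖ ^ 2 := by ring
    linarith
  linarith

/-! ### The coupled error recursion -/

/-- The Lyapunov function of the five normalized errors: `Y` optimality, `X` disagreement,
`T` gradient table, `W` gradient tracking, `G` gradient estimates. -/
noncomputable def lyapunov (h κ m M Y X T W G : ℝ) : ℝ :=
  Y + h * m / 8 * T + 40 * (h * κ ^ 2) * X + 40 * (h * κ ^ 2) * W + h * m / (1000 * M) * G

/-- The contraction of the Lyapunov function in one iteration. Unprimed variables are errors before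
the iteration, primed ones (expected) errors after it; `h = η μ` for the effective step size `η`,
so that `h κ = η ℓ`. -/
lemma lyapunov_contraction {h κ m M a₂ a₁ b₂ b₁ ρ Y X T W G Y' X' T' W' G' : ℝ}
    (hh : 0 < h) (hκ : 1 ≤ κ) (hm : 1 ≤ m) (hmM : m ≤ M)
    (hstep : 288 * M * (h * κ ^ 2) ≤ m)
    (ha₂ : a₂ ≤ 1 / 1000) (ha₁ : a₁ ≤ 1 / 1000000)
    (hb₂ : b₂ ≤ 1 / 1000) (hb₁ : b₁ * (M * κ ^ 2) ≤ m / 100000)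
    (hρ₁ : ρ ≤ h / 2) (hρ₂ : ρ ≤ 1 / (4 * M))
    (hY : 0 ≤ Y) (hX : 0 ≤ X) (hT : 0 ≤ T) (hW : 0 ≤ W) (hG : 0 ≤ G)
    (hW' : 0 ≤ W') (hG' : 0 ≤ G')
    (eY : Y' ≤ (1 + h / 4) * ((1 - 3 / 2 * h) * Y + 2 * (h * κ ^ 2) * X
      + (h * κ) ^ 2 * (4 * Y + 4 * X + 2 * T)) + (1 + 4 / h) * ((h * κ) ^ 2 * W'))
    (eX : X' ≤ a₂ * X + a₁ * (h * κ) ^ 2 * (W' + G'))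
    (eT : T' ≤ (1 - 1 / M) * T + 1 / m * (2 * Y + 2 * X))
    (eW : W' ≤ b₂ * W + b₁ * (G + G'))
    (eG : G' ≤ 4 * Y + 4 * X + 2 * T) :
    lyapunov h κ m M Y' X' T' W' G' ≤ (1 - ρ) * lyapunov h κ m M Y X T W G := by
  have hm0 : 0 < m := by linarith
  have hM0 : 0 < M := by linarith
  have hκ2 : 1 ≤ κ ^ 2 := one_le_pow₀ hκ
  obtain ⟨P, hP⟩ : ∃ P, P = h * κ ^ 2 := ⟨_, rfl⟩
  obtain ⟨k, hk⟩ : ∃ k, k = h * m / M := ⟨_, rfl⟩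
  have hu2 : (h * κ) ^ 2 = h * P := by rw [hP]; ring
  rw [hu2] at eY eX
  rw [← hP] at eY hstep
  have hhP : h ≤ P := by rw [hP]; exact le_mul_of_one_le_right hh.le hκ2
  have hP0 : 0 < P := hh.trans_le hhP
  have hPle : P ≤ 1 / 288 := by
    have : 288 * M * P ≤ M := hstep.trans hmM
    have : M * (288 * P) ≤ M * 1 := by linarith
    linarith [le_of_mul_le_mul_left this hM0]
  have hk0 : 0 < k := by rw [hk]; positivity
  have hkh : k ≤ h := by
    rw [hk, div_le_iff₀ hM0]; exact mul_le_mul_of_nonneg_left hmM hh.le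
  -- the step size bound turns second-order terms into multiples of `h m / M`
  have hhPk : h * P ≤ k / 288 := by
    rw [hk, le_div_iff₀ (by norm_num), le_div_iff₀ hM0]
    linarith [mul_le_mul_of_nonneg_left hstep hh.le]
  have hPb : P * b₁ ≤ k / 100000 := by
    rw [hk, hP, le_div_iff₀ (by norm_num), le_div_iff₀ hM0]
    linarith [mul_le_mul_of_nonneg_left hb₁ hh.le]
  have hhle : h ≤ 1 / 288 := hhP.trans hPle
  have hfrac : (1 + 4 / h) * (h * P * W') ≤ 5 * P * W' := by
    have : (1 + 4 / h) * (h * P * W') = (h + 4) * P * W' := by field_simp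
    rw [this]
    have : 0 ≤ P * W' := by positivity
    linarith [mul_le_mul_of_nonneg_right hhle this]
  have hhP1 : h * P ≤ h / 288 := by linarith [mul_le_mul_of_nonneg_left hPle hh.le]
  have hhP2 : h * P ≤ P / 288 := by linarith [mul_le_mul_of_nonneg_right hhle hP0.le]
  have hhP0 : 0 ≤ h * P := by positivity
  -- optimality error
  have eY1 : Y' ≤ (1 - 6 / 5 * h) * Y + 3 * P * X + k / 100 * T + 5 * P * W' := by
    refine (eY.trans (add_le_add_right hfrac _)).trans ?_
    have c1 : (1 + h / 4) * (1 - 3 / 2 * h + 4 * (h * P)) ≤ 1 - 6 / 5 * h := by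
      linarith [mul_le_mul_of_nonneg_left hhP1 hh.le, sq_nonneg h,
        mul_le_mul_of_nonneg_left hhle hh.le]
    have c2 : (1 + h / 4) * (2 * P + 4 * (h * P)) ≤ 3 * P := by
      linarith [mul_le_mul_of_nonneg_left hhP2 hh.le]
    have c3 : (1 + h / 4) * (2 * (h * P)) ≤ k / 100 := by
      linarith [mul_le_mul_of_nonneg_right hhle hhP0]
    have d1 := mul_le_mul_of_nonneg_right c1 hY
    have d2 := mul_le_mul_of_nonneg_right c2 hX
    have d3 := mul_le_mul_of_nonneg_right c3 hT
    linarith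
  -- disagreement, with its weight
  have eX1 : 40 * P * X' ≤ P / 25 * X + P / 100 * W' + k / 100000 * G' := by
    have e1 : 40 * P * X' ≤ 40 * P * (a₂ * X + a₁ * (h * P) * (W' + G')) :=
      mul_le_mul_of_nonneg_left eX (by positivity)
    have e2 : 40 * P * (a₂ * X) ≤ P / 25 * X := by
      have := mul_le_mul_of_nonneg_right ha₂ (show 0 ≤ 40 * P * X by positivity)
      linarith
    have e3 : a₁ * (h * P) ≤ 1 / 1000000 * (k / 288) :=
      mul_le_mul ha₁ hhPk (by positivity) (by norm_num)
    have e4 : 40 * P * (a₁ * (h * P)) * W' ≤ P / 100 * W' := by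
      refine mul_le_mul_of_nonneg_right ?_ hW'
      have : a₁ * (h * P) ≤ 1 / 4000 := by linarith
      linarith [mul_le_mul_of_nonneg_left this hP0.le]
    have e5 : 40 * P * (a₁ * (h * P)) * G' ≤ k / 100000 * G' := by
      refine mul_le_mul_of_nonneg_right ?_ hG'
      linarith [mul_le_mul_of_nonneg_left e3 hP0.le, mul_le_mul_of_nonneg_right hPle hk0.le]
    linarith
  -- tracking error, with its total weight
  have eW1 : 46 * P * W' ≤ 46 / 1000 * P * W + 46 / 100000 * k * (G + G') := by
    have e1 : 46 * P * W' ≤ 46 * P * (b₂ * W + b₁ * (G + G')) :=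
      mul_le_mul_of_nonneg_left eW (by positivity)
    have e2 := mul_le_mul_of_nonneg_right hb₂ (show 0 ≤ 46 * P * W by positivity)
    have e3 := mul_le_mul_of_nonneg_right hPb (show 0 ≤ 46 * (G + G') by positivity)
    linarith
  -- table error, with its weight
  have eT1 : h * m / 8 * T' ≤ (h * m / 8 - k / 8) * T + h / 4 * (Y + X) := by
    have e1 := mul_le_mul_of_nonneg_left eT (show 0 ≤ h * m / 8 by positivity)
    have e2 : h * m / 8 * ((1 - 1 / M) * T + 1 / m * (2 * Y + 2 * X))
        = (h * m / 8 - k / 8) * T + h / 4 * (Y + X) := by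
      rw [hk]; field_simp; ring
    linarith
  have eG1 := mul_le_mul_of_nonneg_left eG (show 0 ≤ k / 1000 + 47 / 100000 * k by positivity)
  have hδ : h * m / (1000 * M) = k / 1000 := by rw [hk]; field_simp
  have hρ4 : ρ ≤ 1 / 4 := by
    refine hρ₂.trans (one_div_le_one_div_of_le (by norm_num) (by linarith))
  have hρk : ρ * (h * m / 8) ≤ k / 32 := by
    have := mul_le_mul_of_nonneg_right hρ₂ (show 0 ≤ h * m / 8 by positivity)
    have e : 1 / (4 * M) * (h * m / 8) = k / 32 := by rw [hk]; field_simp; norm_num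
    linarith
  have q1 := mul_le_mul_of_nonneg_right hρ₁ hY
  have q2 := mul_le_mul_of_nonneg_right hρk hT
  have q3 := mul_le_mul_of_nonneg_right hρ4 (show 0 ≤ 40 * P * X by positivity)
  have q4 := mul_le_mul_of_nonneg_right hρ4 (show 0 ≤ 40 * P * W by positivity)
  have q5 := mul_le_mul_of_nonneg_right hρ4 (show 0 ≤ k / 1000 * G by positivity)
  have r1 := mul_le_mul_of_nonneg_right hkh hY
  have r2 := mul_le_mul_of_nonneg_right (hkh.trans hhP) hX
  have r3 := mul_le_mul_of_nonneg_right hhP hX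
  have r4 : 0 ≤ P * X := by positivity
  have r5 : 0 ≤ P * W := by positivity
  have r6 : 0 ≤ k * T := by positivity
  have r7 : 0 ≤ k * G := by positivity
  have r8 : 0 ≤ h * Y := by positivity
  have r9 : 0 ≤ P * W' := by positivity
  unfold lyapunov
  rw [hδ, ← hP]
  linarith

/-! ### Constants of the network and the problem -/

lemma iInf_pos_of_pos {n : ℕ} (hn : 0 < n) {π : Fin n → ℝ} (hπ : ∀ i, 0 < π i) :
    0 < ⨅ i, π i := by
  have : Nonempty (Fin n) := ⟨⟨0, hn⟩⟩
  obtain ⟨i, hi⟩ := exists_eq_ciInf_of_finite (f := π)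
  rw [← hi]; exact hπ i

lemma iInf_le_apply {n : ℕ} (π : Fin n → ℝ) (i : Fin n) : ⨅ i, π i ≤ π i :=
  ciInf_le (Set.finite_range π).bddBelow i

lemma le_iSup_apply {n : ℕ} (π : Fin n → ℝ) (i : Fin n) : π i ≤ ⨆ i, π i :=
  le_ciSup (Set.finite_range π).bddAbove i

lemma natCast_mul_iInf_le {n : ℕ} {π : Fin n → ℝ} (h1 : ∑ i, π i = 1) :
    (n : ℝ) * ⨅ i, π i ≤ 1 := by
  rw [← h1]
  simpa using Finset.sum_le_sum fun i (_ : i ∈ Finset.univ) => iInf_le_apply π i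

lemma one_le_natCast_mul_iSup {n : ℕ} {π : Fin n → ℝ} (h1 : ∑ i, π i = 1) :
    1 ≤ (n : ℝ) * ⨆ i, π i := by
  rw [← h1]
  simpa using Finset.sum_le_sum fun i (_ : i ∈ Finset.univ) => le_iSup_apply π i

lemma iInf_le_iSup {n : ℕ} (hn : 0 < n) (π : Fin n → ℝ) : ⨅ i, π i ≤ ⨆ i, π i :=
  (iInf_le_apply π ⟨0, hn⟩).trans (le_iSup_apply π _)

lemma spread_mul_iInf {n : ℕ} (hn : 0 < n) {π : Fin n → ℝ} (hπ : ∀ i, 0 < π i) :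
    spread π * ⨅ i, π i = ⨆ i, π i :=
  div_mul_cancel₀ _ (iInf_pos_of_pos hn hπ).ne'

lemma one_le_spread {n : ℕ} (hn : 0 < n) {π : Fin n → ℝ} (hπ : ∀ i, 0 < π i) :
    1 ≤ spread π := by
  rw [spread, one_le_div (iInf_pos_of_pos hn hπ)]
  exact iInf_le_iSup hn π

lemma dotProduct_pos_of_pos {n : ℕ} (hn : 0 < n) {π₁ π₂ : Fin n → ℝ} (h₁ : ∀ i, 0 < π₁ i)
    (h₂ : ∀ i, 0 < π₂ i) : 0 < dotProduct π₁ π₂ :=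
  Finset.sum_pos (fun i _ => mul_pos (h₁ i) (h₂ i)) ⟨⟨0, hn⟩, Finset.mem_univ _⟩

lemma dotProduct_le_iSup {n : ℕ} {π₁ π₂ : Fin n → ℝ} (h₂ : ∀ i, 0 < π₂ i)
    (h1 : ∑ i, π₂ i = 1) : dotProduct π₁ π₂ ≤ ⨆ i, π₁ i := by
  calc dotProduct π₁ π₂ ≤ ∑ i, (⨆ i, π₁ i) * π₂ i :=
        Finset.sum_le_sum fun i _ => mul_le_mul_of_nonneg_right (le_iSup_apply π₁ i) (h₂ i).le
    _ = ⨆ i, π₁ i := by rw [← Finset.mul_sum, h1, mul_one]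

lemma iSup_le_one {n : ℕ} (hn : 0 < n) {π : Fin n → ℝ} (hπ : ∀ i, 0 < π i)
    (h1 : ∑ i, π i = 1) : ⨆ i, π i ≤ 1 := by
  have : Nonempty (Fin n) := ⟨⟨0, hn⟩⟩
  refine ciSup_le fun i => ?_
  rw [← h1]
  exact Finset.single_le_sum (fun j _ => (hπ j).le) (Finset.mem_univ i)

lemma natCast_mul_dotProduct_le_spread {n : ℕ} (hn : 0 < n) {π₁ π₂ : Fin n → ℝ}
    (h₁ : ∀ i, 0 < π₁ i) (h₂ : ∀ i, 0 < π₂ i) (s₁ : ∑ i, π₁ i = 1) (s₂ : ∑ i, π₂ i = 1) :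
    (n : ℝ) * dotProduct π₁ π₂ ≤ spread π₁ := by
  have hs := one_le_spread hn h₁
  calc (n : ℝ) * dotProduct π₁ π₂ ≤ n * ⨆ i, π₁ i :=
        mul_le_mul_of_nonneg_left (dotProduct_le_iSup h₂ s₂) (Nat.cast_nonneg n)
    _ = spread π₁ * (n * ⨅ i, π₁ i) := by rw [← spread_mul_iInf hn h₁]; ring
    _ ≤ spread π₁ * 1 := mul_le_mul_of_nonneg_left (natCast_mul_iInf_le s₁) (by linarith)
    _ = spread π₁ := mul_one _

lemma one_le_directivity {n : ℕ} (hn : 0 < n) {π₁ π₂ : Fin n → ℝ}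
    (h₁ : ∀ i, 0 < π₁ i) (h₂ : ∀ i, 0 < π₂ i) (s₁ : ∑ i, π₁ i = 1) (s₂ : ∑ i, π₂ i = 1) :
    1 ≤ directivity π₁ π₂ := by
  have hn' : (0 : ℝ) < n := by exact_mod_cast hn
  have hθ := dotProduct_pos_of_pos hn h₁ h₂
  rw [directivity, one_le_div (by positivity)]
  refine Real.le_sqrt_of_sq_le ?_
  rw [sq]
  have h3 := natCast_mul_dotProduct_le_spread hn h₂ h₁ s₂ s₁
  rw [dotProduct_comm] at h3
  exact mul_le_mul (natCast_mul_dotProduct_le_spread hn h₁ h₂ s₁ s₂) h3 (by positivity)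
    (by linarith [one_le_spread hn h₁])

lemma le_maxSize {n : ℕ} (m : Fin n → ℕ) (i : Fin n) : m i ≤ maxSize m :=
  le_ciSup (Set.finite_range m).bddAbove i

lemma minSize_le {n : ℕ} (m : Fin n → ℕ) (i : Fin n) : minSize m ≤ m i :=
  ciInf_le (OrderBot.bddBelow _) i

lemma one_le_minSize {n : ℕ} (hn : 0 < n) {m : Fin n → ℕ} (hm : ∀ i, 0 < m i) :
    1 ≤ minSize m := by
  have : Nonempty (Fin n) := ⟨⟨0, hn⟩⟩
  exact le_ciInf fun i => hm i

lemma minSize_le_maxSize {n : ℕ} (hn : 0 < n) (m : Fin n → ℕ) : minSize m ≤ maxSize m :=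
  (minSize_le m ⟨0, hn⟩).trans (le_maxSize m _)

/-- Enough communication rounds push the contraction factor below `1 / L`. If `σ = 0`, the bound on
the number of rounds is `0` by the convention `x / 0 = 0`, and one round suffices. -/
lemma pow_mul_le_one_of_log_le {σ L : ℝ} (hσ0 : 0 ≤ σ) (hσ1 : σ < 1) (hL : 0 < L) {c : ℕ}
    (hc1 : 1 ≤ c) (hc : Real.log L / Real.log (1 / σ) ≤ c) : σ ^ c * L ≤ 1 := by
  rcases hσ0.eq_or_lt with h | h
  · rw [← h, zero_pow (by omega), zero_mul]; exact zero_le_one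
  · have hlog : 0 < Real.log (1 / σ) := Real.log_pos (by rw [lt_div_iff₀ h]; linarith)
    rw [div_le_iff₀ hlog, ← Real.log_pow] at hc
    have h1 := (Real.log_le_log_iff hL (by positivity)).1 hc
    rw [one_div, inv_pow] at h1
    calc σ ^ c * L ≤ σ ^ c * (σ ^ c)⁻¹ := by gcongr
      _ = 1 := mul_inv_cancel₀ (by positivity)

/-- The standing data of the convergence proof: the problem with its stationary point `xstar`, and
the two weight matrices with their Perron vectors. -/
structure Setting {n p : ℕ} (m : Fin n → ℕ) (f : (i : Fin n) → Fin (m i) → Vec p → ℝ) (μ ℓ : ℝ)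
    (A B : Matrix (Fin n) (Fin n) ℝ) (πr πc : Fin n → ℝ) (xstar : Vec p) : Prop where
  n_pos : 0 < n
  m_pos : ∀ i, 0 < m i
  μ_pos : 0 < μ
  μ_le : μ ≤ ℓ
  smooth : ∀ i j, IsSmooth ℓ (f i j)
  mono : ∀ x y, μ * ‖x - y‖ ^ 2 ≤ inner ℝ (globalGrad f x - globalGrad f y) (x - y)
  stationary : globalGrad f xstar = 0
  row : RowPair A πr
  col : ColPair B πc

section Bounds

variable {n p : ℕ} {m : Fin n → ℕ} {f : (i : Fin n) → Fin (m i) → Vec p → ℝ} {μ ℓ : ℝ}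
  {A B : Matrix (Fin n) (Fin n) ℝ} {πr πc : Fin n → ℝ} {xstar : Vec p}

lemma Setting.ℓ_pos (H : Setting m f μ ℓ A B πr πc xstar) : 0 < ℓ := H.μ_pos.trans_le H.μ_le

lemma Setting.one_le_κ (H : Setting m f μ ℓ A B πr πc xstar) : 1 ≤ ℓ / μ :=
  (one_le_div H.μ_pos).2 H.μ_le

lemma Setting.θ_pos (H : Setting m f μ ℓ A B πr πc xstar) : 0 < dotProduct πr πc :=
  dotProduct_pos_of_pos H.n_pos H.row.pos H.col.pos

lemma Setting.θ_le_one (H : Setting m f μ ℓ A B πr πc xstar) : dotProduct πr πc ≤ 1 :=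
  (dotProduct_le_iSup H.col.pos H.col.sum_one).trans
    (iSup_le_one H.n_pos H.row.pos H.row.sum_one)

lemma Setting.one_le_n (H : Setting m f μ ℓ A B πr πc xstar) : (1 : ℝ) ≤ n := by
  exact_mod_cast H.n_pos

lemma Setting.one_le_min (H : Setting m f μ ℓ A B πr πc xstar) : (1 : ℝ) ≤ minSize m := by
  exact_mod_cast one_le_minSize H.n_pos H.m_pos

lemma Setting.min_le_max (H : Setting m f μ ℓ A B πr πc xstar) :
    (minSize m : ℝ) ≤ maxSize m := by
  exact_mod_cast minSize_le_maxSize H.n_pos m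

lemma Setting.sigmaCol_lt_one (H : Setting m f μ ℓ A B πr πc xstar) : sigmaCol B πc < 1 := by
  rw [H.col.sigmaCol_eq]; exact H.col.rowPair.sigmaRow_lt_one

lemma Setting.stepBound_pos (H : Setting m f μ ℓ A B πr πc xstar) :
    0 < stepBound m μ ℓ πr πc := by
  have hℓ := H.ℓ_pos; have hμ := H.μ_pos; have hθ := H.θ_pos
  have hn : (0 : ℝ) < n := by linarith [H.one_le_n]
  have hm : (0 : ℝ) < minSize m := by linarith [H.one_le_min]
  have hM : (0 : ℝ) < maxSize m := hm.trans_le H.min_le_max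
  have hr : 0 < spread πr := by linarith [one_le_spread H.n_pos H.row.pos]
  have hc : 0 < spread πc := by linarith [one_le_spread H.n_pos H.col.pos]
  unfold stepBound
  refine lt_min (by positivity) (lt_min (by positivity) (by positivity))

/-- The number `d` of rounds makes the mixing error of the trackers small. -/
lemma Setting.sigmaCol_pow_bound (H : Setting m f μ ℓ A B πr πc xstar) {d : ℕ} (hd1 : 1 ≤ d)
    (hd : dBar m μ ℓ B πr πc ≤ d) :
    (sigmaCol B πc ^ d) ^ 2 * (1265 ^ 2 * (ℓ / μ) ^ 2 * (n * maxSize m * spread πc))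
      ≤ dotProduct πr πc ^ 2 * minSize m := by
  have hθ := H.θ_pos
  have hκ : 0 < ℓ / μ := by linarith [H.one_le_κ]
  have hn : (0 : ℝ) < n := by linarith [H.one_le_n]
  have hm : (0 : ℝ) < minSize m := by linarith [H.one_le_min]
  have hM : (0 : ℝ) < maxSize m := hm.trans_le H.min_le_max
  have hc : 0 < spread πc := by linarith [one_le_spread H.n_pos H.col.pos]
  have hb0 := sigmaCol_nonneg B πc
  have h1 := pow_mul_le_one_of_log_le hb0 H.sigmaCol_lt_one (by positivity) hd1 hd
  have h2 := pow_le_pow_left₀ (by positivity) h1 2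
  rw [mul_pow, mul_pow, Real.sq_sqrt (by positivity), one_pow] at h2
  have e : (sigmaCol B πc ^ d) ^ 2 * ((1265 * (ℓ / μ) / dotProduct πr πc) ^ 2 *
      ((n : ℝ) * maxSize m * spread πc / minSize m))
      = (sigmaCol B πc ^ d) ^ 2 * (1265 ^ 2 * (ℓ / μ) ^ 2 * (n * maxSize m * spread πc))
        / (dotProduct πr πc ^ 2 * minSize m) := by
    field_simp
  rw [e, div_le_one (by positivity)] at h2
  exact h2

/-- The number `c` of rounds makes the disagreement of the iterates small. -/
lemma Setting.sigmaRow_pow_bound (H : Setting m f μ ℓ A B πr πc xstar) {c d : ℕ} (hc1 : 1 ≤ c)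
    (hd1 : 1 ≤ d) (hc : cBar m μ ℓ A B πr πc d ≤ c) :
    (sigmaRow A πr ^ c) ^ 2 * (90512 ^ 2 * n ^ 2 * maxSize m ^ 2 * (ℓ / μ) ^ 2
      * (spread πr * spread πc)) ≤ minSize m ^ 2 * dotProduct πr πc := by
  have hθ := H.θ_pos
  have hκ : 0 < ℓ / μ := by linarith [H.one_le_κ]
  have hn : (0 : ℝ) < n := by linarith [H.one_le_n]
  have hm : (0 : ℝ) < minSize m := by linarith [H.one_le_min]
  have hM : (0 : ℝ) < maxSize m := hm.trans_le H.min_le_max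
  have hsr : 0 < spread πr := by linarith [one_le_spread H.n_pos H.row.pos]
  have hsc : 0 < spread πc := by linarith [one_le_spread H.n_pos H.col.pos]
  have hb0 := sigmaCol_nonneg B πc
  have ha0 := sigmaRow_nonneg A πr
  have hb : sigmaCol B πc ^ (2 * d) < 1 := pow_lt_one₀ hb0 H.sigmaCol_lt_one (by omega)
  have hb' : 0 < 1 - sigmaCol B πc ^ (2 * d) := by linarith
  have hb'' : 1 - sigmaCol B πc ^ (2 * d) ≤ 1 := by linarith [pow_nonneg hb0 (2 * d)]
  unfold cBar at hc
  generalize 1 - sigmaCol B πc ^ (2 * d) = D at *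
  have h1 := pow_mul_le_one_of_log_le ha0 H.row.sigmaRow_lt_one (by positivity) hc1 hc
  have h2 := pow_le_pow_left₀ (by positivity) h1 2
  rw [mul_pow, mul_pow, Real.sq_sqrt (by positivity), one_pow] at h2
  have e : (sigmaRow A πr ^ c) ^ 2 * ((90512 * n * maxSize m * (ℓ / μ) / (minSize m * D)) ^ 2 *
      (spread πr * spread πc / dotProduct πr πc))
      = (sigmaRow A πr ^ c) ^ 2 * (90512 ^ 2 * n ^ 2 * maxSize m ^ 2 * (ℓ / μ) ^ 2
      * (spread πr * spread πc)) / (minSize m ^ 2 * D ^ 2 * dotProduct πr πc) := by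
    field_simp
  rw [e, div_le_one (by positivity)] at h2
  refine h2.trans ?_
  have hD2 : D ^ 2 ≤ 1 := pow_le_one₀ hb'.le hb''
  have : 0 ≤ (minSize m : ℝ) ^ 2 * dotProduct πr πc := by positivity
  nlinarith

/-- The four mixing coefficients of the error recursion are small. -/
lemma Setting.mixing_bounds (H : Setting m f μ ℓ A B πr πc xstar) {c d : ℕ} (hc1 : 1 ≤ c)
    (hd1 : 1 ≤ d) (hd : dBar m μ ℓ B πr πc ≤ d) (hc : cBar m μ ℓ A B πr πc d ≤ c) :
    2 * (sigmaRow A πr ^ c) ^ 2 ≤ 1 / 1000 ∧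
    4 * (sigmaRow A πr ^ c) ^ 2 * (⨆ i, πc i) / (n * dotProduct πr πc * ⨅ i, πr i)
      ≤ 1 / 1000000 ∧
    2 * (sigmaCol B πc ^ d) ^ 2 ≤ 1 / 1000 ∧
    4 * (sigmaCol B πc ^ d) ^ 2 * (⨆ i, πr i) / (n * dotProduct πr πc * ⨅ i, πc i)
      * (maxSize m * (ℓ / μ) ^ 2) ≤ minSize m / 100000 := by
  have hB := H.sigmaCol_pow_bound hd1 hd
  have hA := H.sigmaRow_pow_bound hc1 hd1 hc
  have hθ := H.θ_pos
  have hθ1 := H.θ_le_one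
  have hκ1 := H.one_le_κ
  have hn1 := H.one_le_n
  have hm1 := H.one_le_min
  have hmM := H.min_le_max
  have hsr := one_le_spread H.n_pos H.row.pos
  have hsc := one_le_spread H.n_pos H.col.pos
  have hri := iInf_pos_of_pos H.n_pos H.row.pos
  have hci := iInf_pos_of_pos H.n_pos H.col.pos
  have hrs := iSup_le_one H.n_pos H.row.pos H.row.sum_one
  have hcn := natCast_mul_iInf_le H.col.sum_one
  have hrn := one_le_natCast_mul_iSup H.row.sum_one
  have hcN := one_le_natCast_mul_iSup H.col.sum_one
  have er := spread_mul_iInf H.n_pos H.row.pos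
  have ec := spread_mul_iInf H.n_pos H.col.pos
  rw [← ec] at hcN ⊢
  rw [← er] at hrs hrn ⊢
  generalize ℓ / μ = κ at *
  generalize dotProduct πr πc = θ at *
  generalize spread πr = hr at *
  generalize spread πc = hc' at *
  generalize (⨅ i, πr i) = ri at *
  generalize (⨅ i, πc i) = ci at *
  generalize (n : ℝ) = N at *
  generalize (minSize m : ℝ) = mm at *
  generalize (maxSize m : ℝ) = M at *
  obtain ⟨a, ha⟩ : ∃ a, a = (sigmaRow A πr ^ c) ^ 2 := ⟨_, rfl⟩
  obtain ⟨b, hb⟩ : ∃ b, b = (sigmaCol B πc ^ d) ^ 2 := ⟨_, rfl⟩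
  have ha0 : 0 ≤ a := ha ▸ sq_nonneg _
  have hb0 : 0 ≤ b := hb ▸ sq_nonneg _
  rw [← ha, ← hb]
  rw [← ha] at hA
  rw [← hb] at hB
  have hκ2 : 1 ≤ κ ^ 2 := one_le_pow₀ hκ1
  have hN0 : 0 < N := by linarith
  have hm0 : 0 < mm := by linarith
  have hM0 : 0 < M := by linarith
  have hM1 : 1 ≤ M := by linarith
  -- `a h_r h_c ≤ θ / 90512²`
  have hA' : a * (hr * hc') * 90512 ^ 2 ≤ θ := by
    have h1 : M ^ 2 * (a * (hr * hc') * 90512 ^ 2) ≤ M ^ 2 * θ := by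
      have h2 : 1 ≤ N ^ 2 * κ ^ 2 := one_le_mul_of_one_le_of_one_le (one_le_pow₀ hn1) hκ2
      have h3 : 0 ≤ M ^ 2 * (a * (hr * hc') * 90512 ^ 2) := by positivity
      have h4 := mul_le_mul_of_nonneg_left h2 h3
      have h5 : mm ^ 2 * θ ≤ M ^ 2 * θ := by gcongr
      linarith
    exact le_of_mul_le_mul_left h1 (by positivity)
  have hhh : 1 ≤ hr * hc' := one_le_mul_of_one_le_of_one_le hsr hsc
  have haa : a ≤ a * (hr * hc') := le_mul_of_one_le_right ha0 hhh
  -- `b h_c n M κ² ≤ θ² m / 1265²`, where `m ≤ M`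
  have hB' : b * 1265 ^ 2 ≤ 1 := by
    have h1 : M * (b * 1265 ^ 2) ≤ M * 1 := by
      have h2 : 1 ≤ κ ^ 2 * (N * hc') :=
        one_le_mul_of_one_le_of_one_le hκ2 (one_le_mul_of_one_le_of_one_le hn1 hsc)
      have h4 := mul_le_mul_of_nonneg_left h2 (show 0 ≤ M * (b * 1265 ^ 2) by positivity)
      have h5 : θ ^ 2 * mm ≤ 1 * M := by
        have : θ ^ 2 ≤ 1 := pow_le_one₀ hθ.le hθ1
        gcongr
      linarith
    exact le_of_mul_le_mul_left h1 hM0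
  refine ⟨by linarith, ?_, by linarith, ?_⟩
  · rw [div_le_iff₀ (by positivity)]
    -- `c_min ≤ 1 / n ≤ r_max = h_r r_min`
    have h1 : ci ≤ hr * ri := by
      have : N * ci ≤ N * (hr * ri) := hcn.trans hrn
      exact le_of_mul_le_mul_left this hN0
    have h2 : a * (hc' * ci) ≤ a * (hr * hc') * ri := by
      have := mul_le_mul_of_nonneg_left h1 (show 0 ≤ a * hc' by positivity)
      linarith
    have h3 : a * (hr * hc') * ri * 90512 ^ 2 ≤ θ * ri := by
      have := mul_le_mul_of_nonneg_right hA' hri.le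
      linarith
    have h4 : θ * ri ≤ N * θ * ri := by
      have := mul_le_mul_of_nonneg_right hn1 (show 0 ≤ θ * ri by positivity)
      linarith
    have h5 : 0 ≤ N * θ * ri := by positivity
    linarith
  · have h1 : 4 * b * (hr * ri) / (N * θ * ci) * (M * κ ^ 2) * 1265 ^ 2
        ≤ 4 * (hr * ri) * θ * mm / (N * (N * (hc' * ci))) := by
      have e1 : 4 * b * (hr * ri) / (N * θ * ci) * (M * κ ^ 2) * 1265 ^ 2
          = b * (1265 ^ 2 * κ ^ 2 * (N * M * hc')) * (4 * (hr * ri) / (N * N * θ * ci * hc')) := by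
        field_simp
      have e2 : 4 * (hr * ri) * θ * mm / (N * (N * (hc' * ci)))
          = θ ^ 2 * mm * (4 * (hr * ri) / (N * N * θ * ci * hc')) := by
        field_simp
      rw [e1, e2]
      exact mul_le_mul_of_nonneg_right hB (by positivity)
    have h2 : 4 * (hr * ri) * θ * mm / (N * (N * (hc' * ci))) ≤ 4 * mm := by
      rw [div_le_iff₀ (by positivity)]
      have h3 : 1 ≤ N * (N * (hc' * ci)) := one_le_mul_of_one_le_of_one_le hn1 hcN
      have h4 : hr * ri * θ ≤ 1 := mul_le_one₀ hrs hθ.le hθ1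
      have h5 := mul_le_mul_of_nonneg_right h4 hm0.le
      have h6 := mul_le_mul_of_nonneg_left h3 hm0.le
      linarith
    linarith

end Bounds

/-! ### One iteration in expectation -/

/-- The Lyapunov function of a state. The optimality error and the disagreement are those of the
next iterate, which is determined by the state before the next indices are drawn. All errors are
scaled to per-node squared distances; the scaling of the tracking error makes `(ηℓ)²` times it bound
the squared deviation that inexact tracking causes in the mean update. -/
noncomputable def stateLyapunov {n p : ℕ} {m : Fin n → ℕ}
    (f : (i : Fin n) → Fin (m i) → Vec p → ℝ) (μ ℓ : ℝ) (A : Matrix (Fin n) (Fin n) ℝ)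
    (πr πc : Fin n → ℝ) (xstar : Vec p) (α : ℝ) (c : ℕ) (S : State n p m) : ℝ :=
  lyapunov (n * dotProduct πr πc * α * μ) (ℓ / μ) (minSize m) (maxSize m)
    (optErr πr xstar (nextX A α c S))
    (consErr πr (nextX A α c S) / (n * ⨅ i, πr i))
    (tableErr f xstar S.table / (n * ℓ ^ 2))
    ((⨆ i, πr i) / (n ^ 2 * dotProduct πr πc * ℓ ^ 2) * trackErr πc S.w)
    (gradErr f xstar S.g / (n * ℓ ^ 2))

lemma sum_mul_lyapunov {ι : Type*} [Fintype ι] (h κ m M : ℝ) (q Y X T W G : ι → ℝ) :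
    ∑ s, q s * lyapunov h κ m M (Y s) (X s) (T s) (W s) (G s)
      = lyapunov h κ m M (∑ s, q s * Y s) (∑ s, q s * X s) (∑ s, q s * T s) (∑ s, q s * W s)
        (∑ s, q s * G s) := by
  simp only [lyapunov, Finset.mul_sum, ← Finset.sum_add_distrib]
  exact Finset.sum_congr rfl fun s _ => by ring

lemma sum_mul_le_of_forall {ι : Type*} [Fintype ι] {q F G : ι → ℝ} (hq : ∀ s, 0 ≤ q s)
    (h : ∀ s, F s ≤ G s) : ∑ s, q s * F s ≤ ∑ s, q s * G s :=
  Finset.sum_le_sum fun s _ => mul_le_mul_of_nonneg_left (h s) (hq s)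

lemma sum_mul_affine {ι : Type*} [Fintype ι] {q : ι → ℝ} (hq : ∑ s, q s = 1) (F : ι → ℝ)
    (φ : ℝ → ℝ) (a b : ℝ) (hφ : ∀ e, φ e = a * e + b) :
    ∑ s, q s * φ (F s) = φ (∑ s, q s * F s) := by
  simp_rw [hφ, mul_add]
  rw [Finset.sum_add_distrib, ← Finset.sum_mul, hq, one_mul, Finset.mul_sum]
  congr 1
  exact Finset.sum_congr rfl fun s _ => by ring

section Step

variable {n p : ℕ} {m : Fin n → ℕ} {f : (i : Fin n) → Fin (m i) → Vec p → ℝ} {μ ℓ : ℝ}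
  {A B : Matrix (Fin n) (Fin n) ℝ} {πr πc : Fin n → ℝ} {xstar : Vec p}

/-- The contraction rate `ρ = min (ημ/2) (1/(4M))`, where `η = n (πrᵀ πc) α` is the step size which
the mean iterate experiences. -/
noncomputable def rate (m : Fin n → ℕ) (μ : ℝ) (πr πc : Fin n → ℝ) (α : ℝ) : ℝ :=
  min (n * dotProduct πr πc * α * μ / 2) (1 / (4 * maxSize m))

lemma Setting.step_smallness (H : Setting m f μ ℓ A B πr πc xstar) {α : ℝ}
    (hα1 : α ≤ stepBound m μ ℓ πr πc) :
    288 * maxSize m * ((n * dotProduct πr πc * α * μ) * (ℓ / μ) ^ 2) ≤ minSize m := by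
  have hθ := H.θ_pos
  have hκ : 0 < ℓ / μ := by linarith [H.one_le_κ]
  have hn : (0 : ℝ) < n := by linarith [H.one_le_n]
  have hm : (0 : ℝ) < minSize m := by linarith [H.one_le_min]
  have hM : (0 : ℝ) < maxSize m := hm.trans_le H.min_le_max
  have hℓ := H.ℓ_pos
  have hμ := H.μ_pos
  have h1 : α ≤ (minSize m : ℝ) / (288 * (maxSize m : ℝ) * (n : ℝ) * (ℓ / μ) * ℓ *
      dotProduct πr πc) := hα1.trans ((min_le_right _ _).trans (min_le_left _ _))
  rw [le_div_iff₀ (by positivity)] at h1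
  refine le_trans (le_of_eq ?_) h1
  field_simp

/-- One iteration contracts the expected Lyapunov function. -/
lemma Setting.step_contraction (H : Setting m f μ ℓ A B πr πc xstar) {c d : ℕ} (hc1 : 1 ≤ c)
    (hd1 : 1 ≤ d) (hd : dBar m μ ℓ B πr πc ≤ d) (hc : cBar m μ ℓ A B πr πc d ≤ c) {α : ℝ}
    (hα0 : 0 < α) (hα1 : α ≤ stepBound m μ ℓ πr πc) {q : ((i : Fin n) → Fin (m i)) → ℝ}
    (hq : UniformWeights m q) {S : State n p m} (hS : ∑ i, S.w i = ∑ i, S.g i) :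
    ∑ s, q s * stateLyapunov f μ ℓ A πr πc xstar α c (step f A B α c d s S)
      ≤ (1 - rate m μ πr πc α) * stateLyapunov f μ ℓ A πr πc xstar α c S := by
  obtain ⟨ha₂, ha₁, hb₂, hb₁⟩ := H.mixing_bounds hc1 hd1 hd hc
  have hsmall := H.step_smallness hα1
  have hθ := H.θ_pos
  have hκ := H.one_le_κ
  have hn : (0 : ℝ) < n := by linarith [H.one_le_n]
  have hm := H.one_le_min
  have hmM := H.min_le_max
  have hℓ := H.ℓ_pos
  have hμ := H.μ_pos
  have hri := iInf_pos_of_pos H.n_pos H.row.pos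
  have hci := iInf_pos_of_pos H.n_pos H.col.pos
  have hrs : 0 < ⨆ i, πr i := hri.trans_le (iInf_le_iSup H.n_pos _)
  have hcs : 0 < ⨆ i, πc i := hci.trans_le (iInf_le_iSup H.n_pos _)
  have hh : 0 < n * dotProduct πr πc * α * μ := by positivity
  set x := nextX A α c S with hx
  -- quantities after the draw `s`
  set g' : ((i : Fin n) → Fin (m i)) → Fin n → Vec p :=
    fun s i => sagaEst f i (x i) (S.table i) (s i) with hg'
  set w' : ((i : Fin n) → Fin (m i)) → Fin n → Vec p :=
    fun s i => ∑ r, (B ^ d) i r • (S.w r + g' s r - S.g r) with hw'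
  have hsumw : ∀ s, ∑ i, w' s i = ∑ i, g' s i := by
    intro s
    rw [hw', H.col.sum_pow d, Finset.sum_sub_distrib, Finset.sum_add_distrib, hS]
    abel
  set D := ∑ i, ‖x i - xstar‖ ^ 2 with hD
  obtain ⟨hC, hDle⟩ := sum_norm_sub_sq_le hri (iInf_le_apply πr) xstar x
  have hDn : D / n ≤ 2 * optErr πr xstar x + 2 * (consErr πr x / (n * ⨅ i, πr i)) := by
    rw [div_le_iff₀ hn]
    refine hDle.trans (le_of_eq ?_)
    field_simp
  have hE : ∑ s, q s * gradErr f xstar (g' s) ≤ 2 * ℓ ^ 2 * D + 2 * tableErr f xstar S.table :=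
    hq.gradErr_le H.m_pos H.smooth xstar x S.table
  have htrack : ∀ s, trackErr πc (w' s) ≤ (sigmaCol B πc ^ d) ^ 2 * (2 * trackErr πc S.w
      + 4 / (⨅ i, πc i) * (gradErr f xstar S.g + gradErr f xstar (g' s))) := fun s =>
    H.col.trackErr_le hci (iInf_le_apply πc) d xstar S.w S.g (g' s)
  have hgs : ∀ s, ‖∑ i, g' s i‖ ^ 2 ≤ n * gradErr f xstar (g' s) := by
    intro s
    have hstar' : ∑ i, localGrad f i xstar = 0 :=
      (smul_eq_zero.1 H.stationary).resolve_left (by positivity)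
    have h1 := norm_sum_sq_le fun i => g' s i - localGrad f i xstar
    rw [Finset.sum_sub_distrib, hstar', sub_zero, Fintype.card_fin] at h1
    exact h1
  have hcons : ∀ s, consErr πr (fun i => ∑ r, (A ^ c) i r • (x r - α • w' s r))
      ≤ (sigmaRow A πr ^ c) ^ 2 * (2 * consErr πr x + 2 * α ^ 2 *
        (2 * ((⨆ i, πr i) * (⨆ i, πc i) * trackErr πc (w' s))
          + 2 * ((⨆ i, πc i) * dotProduct πr πc * (n * gradErr f xstar (g' s))))) := by
    intro s
    refine (H.row.consErr_le c α x (w' s)).trans ?_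
    have h1 := sum_mul_norm_sq_le H.row.pos H.col.pos (le_iSup_apply πr) (le_iSup_apply πc) (w' s)
    rw [hsumw] at h1
    have h2 := mul_le_mul_of_nonneg_left (hgs s)
      (show 0 ≤ (⨆ i, πc i) * dotProduct πr πc by positivity)
    gcongr
    linarith
  have hopt : ∀ s, optErr πr xstar (fun i => ∑ r, (A ^ c) i r • (x r - α • w' s r))
      ≤ (1 + n * dotProduct πr πc * α * μ / 4)
          * ‖(∑ r, πr r • x r - xstar) - (α * dotProduct πr πc) • ∑ i, g' s i‖ ^ 2
        + (1 + 4 / (n * dotProduct πr πc * α * μ))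
          * (α ^ 2 * ((⨆ i, πr i) * dotProduct πr πc * trackErr πc (w' s))) := by
    intro s
    have h1 := H.row.optErr_le H.col.pos (le_iSup_apply πr) c α xstar x (w' s)
      (ζ := n * dotProduct πr πc * α * μ / 4) (by positivity)
    rw [hsumw, one_div_div] at h1
    exact h1
  have hdesc := hq.descent H.n_pos H.m_pos hμ H.smooth H.mono H.stationary
    (β := α * dotProduct πr πc) (by positivity) (∑ r, πr r • x r) x S.table
  have htab := hq.tableErr_le H.m_pos (mmin := minSize m) (mmax := maxSize m)
    (by linarith) (fun i => by exact_mod_cast minSize_le m i)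
    (fun i => by exact_mod_cast le_maxSize m i) H.smooth xstar x S.table
  have h1q := hq.sum_one H.n_pos H.m_pos
  obtain ⟨EG, hEG⟩ : ∃ e, e = ∑ s, q s * gradErr f xstar (g' s) := ⟨_, rfl⟩
  obtain ⟨EW, hEW⟩ : ∃ e, e = ∑ s, q s * trackErr πc (w' s) := ⟨_, rfl⟩
  rw [← hEG] at hE
  have eqG : ∑ s, q s * (gradErr f xstar (step f A B α c d s S).g / (n * ℓ ^ 2))
      = EG / (n * ℓ ^ 2) := by
    rw [hEG, Finset.sum_div]
    exact Finset.sum_congr rfl fun s _ => mul_div_assoc' _ _ _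
  have eqW : ∑ s, q s * ((⨆ i, πr i) / (n ^ 2 * dotProduct πr πc * ℓ ^ 2)
      * trackErr πc (step f A B α c d s S).w)
      = (⨆ i, πr i) / (n ^ 2 * dotProduct πr πc * ℓ ^ 2) * EW := by
    rw [hEW, Finset.mul_sum]
    exact Finset.sum_congr rfl fun s _ => mul_left_comm _ _ _
  have hEG0 : 0 ≤ EG := hEG ▸ Finset.sum_nonneg fun s _ =>
    mul_nonneg (hq.nonneg s) (gradErr_nonneg _ _ _)
  have hEW0 : 0 ≤ EW := hEW ▸ Finset.sum_nonneg fun s _ =>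
    mul_nonneg (hq.nonneg s) (trackErr_nonneg H.col.pos _)
  have hT0 := tableErr_nonneg f xstar S.table
  have hEW' : EW ≤ (sigmaCol B πc ^ d) ^ 2 * (2 * trackErr πc S.w
      + 4 / (⨅ i, πc i) * (gradErr f xstar S.g + EG)) := by
    rw [hEW]
    refine (sum_mul_le_of_forall hq.nonneg htrack).trans (le_of_eq ?_)
    rw [sum_mul_affine h1q (fun s => gradErr f xstar (g' s))
      (fun e => (sigmaCol B πc ^ d) ^ 2 * (2 * trackErr πc S.w
        + 4 / (⨅ i, πc i) * (gradErr f xstar S.g + e)))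
      ((sigmaCol B πc ^ d) ^ 2 * (4 / (⨅ i, πc i)))
      ((sigmaCol B πc ^ d) ^ 2 * (2 * trackErr πc S.w + 4 / (⨅ i, πc i) * gradErr f xstar S.g))
      (fun e => by ring), ← hEG]
  have hEX : ∑ s, q s * consErr πr (nextX A α c (step f A B α c d s S))
      ≤ (sigmaRow A πr ^ c) ^ 2 * (2 * consErr πr x + 2 * α ^ 2 *
        (2 * ((⨆ i, πr i) * (⨆ i, πc i) * EW)
          + 2 * ((⨆ i, πc i) * dotProduct πr πc * (n * EG)))) := by
    refine (sum_mul_le_of_forall hq.nonneg hcons).trans (le_of_eq ?_)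
    rw [hEG, hEW]
    have e0 : (sigmaRow A πr ^ c) ^ 2 * (2 * consErr πr x)
        = ∑ s, q s * ((sigmaRow A πr ^ c) ^ 2 * (2 * consErr πr x)) := by
      rw [← Finset.sum_mul, h1q, one_mul]
    rw [mul_add, e0]
    simp only [Finset.mul_sum, ← Finset.sum_add_distrib]
    exact Finset.sum_congr rfl fun s _ => by ring
  have hEY : ∑ s, q s * optErr πr xstar (nextX A α c (step f A B α c d s S))
      ≤ (1 + n * dotProduct πr πc * α * μ / 4) * (∑ s, q s *
          ‖(∑ r, πr r • x r - xstar) - (α * dotProduct πr πc) • ∑ i, g' s i‖ ^ 2)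
        + (1 + 4 / (n * dotProduct πr πc * α * μ))
          * (α ^ 2 * ((⨆ i, πr i) * dotProduct πr πc * EW)) := by
    refine (sum_mul_le_of_forall hq.nonneg hopt).trans (le_of_eq ?_)
    rw [hEW]
    simp only [Finset.mul_sum, ← Finset.sum_add_distrib]
    exact Finset.sum_congr rfl fun s _ => by ring
  unfold stateLyapunov
  rw [sum_mul_lyapunov, eqG, eqW, ← hx]
  refine lyapunov_contraction (a₂ := 2 * (sigmaRow A πr ^ c) ^ 2)
    (a₁ := 4 * (sigmaRow A πr ^ c) ^ 2 * (⨆ i, πc i) / (n * dotProduct πr πc * ⨅ i, πr i))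
    (b₂ := 2 * (sigmaCol B πc ^ d) ^ 2)
    (b₁ := 4 * (sigmaCol B πc ^ d) ^ 2 * (⨆ i, πr i) / (n * dotProduct πr πc * ⨅ i, πc i))
    hh hκ hm hmM hsmall ha₂ ha₁ hb₂ hb₁ (min_le_left _ _) (min_le_right _ _)
    (optErr_nonneg _ _ _) ?_ ?_ ?_ ?_ ?_ ?_ ?_ ?_ ?_ ?_ ?_
  · exact div_nonneg (consErr_nonneg H.row.pos _) (by positivity)
  · exact div_nonneg (tableErr_nonneg _ _ _) (by positivity)
  · exact mul_nonneg (by positivity) (trackErr_nonneg H.col.pos _)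
  · exact div_nonneg (gradErr_nonneg _ _ _) (by positivity)
  · positivity
  · positivity
  · refine hEY.trans (add_le_add (mul_le_mul_of_nonneg_left (hdesc.trans ?_) (by positivity))
      (le_of_eq ?_))
    · have e1 : 2 * (α * dotProduct πr πc) * ℓ ^ 2 / μ * ∑ i, ‖x i - ∑ r, πr r • x r‖ ^ 2
          ≤ 2 * (n * dotProduct πr πc * α * μ * (ℓ / μ) ^ 2)
            * (consErr πr x / (n * ⨅ i, πr i)) := by
        refine (mul_le_mul_of_nonneg_left hC (by positivity)).trans (le_of_eq ?_)
        field_simp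
      have e2 : (α * dotProduct πr πc) ^ 2 * (n * (2 * ℓ ^ 2 * D + 2 * tableErr f xstar S.table))
          = (n * dotProduct πr πc * α * μ * (ℓ / μ)) ^ 2
            * (2 * (D / n) + 2 * (tableErr f xstar S.table / (n * ℓ ^ 2))) := by
        field_simp
      have e3 := mul_le_mul_of_nonneg_left hDn
        (show 0 ≤ (n * dotProduct πr πc * α * μ * (ℓ / μ)) ^ 2 * 2 by positivity)
      rw [e2]
      have e4 : α * dotProduct πr πc * n * μ = n * dotProduct πr πc * α * μ := by ring
      rw [e4]
      change _ * optErr πr xstar x + _ + _ ≤ _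
      linarith
    · congr 1
      field_simp
  · have e : ∀ X' : ((i : Fin n) → Fin (m i)) → ℝ, ∑ s, q s * (X' s / (n * ⨅ i, πr i))
        = (∑ s, q s * X' s) / (n * ⨅ i, πr i) := fun X' => by
      rw [Finset.sum_div]
      exact Finset.sum_congr rfl fun s _ => mul_div_assoc' _ _ _
    rw [e, div_le_iff₀ (by positivity)]
    refine hEX.trans (le_of_eq ?_)
    field_simp
    ring
  · have e : ∑ s, q s * (tableErr f xstar (step f A B α c d s S).table / (n * ℓ ^ 2))
        = (∑ s, q s * tableErr f xstar (step f A B α c d s S).table) / (n * ℓ ^ 2) := by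
      rw [Finset.sum_div]
      exact Finset.sum_congr rfl fun s _ => mul_div_assoc' _ _ _
    rw [e]
    have e1 := div_le_div_of_nonneg_right htab (show 0 ≤ n * ℓ ^ 2 by positivity)
    refine e1.trans ?_
    have e2 : ((1 - 1 / (maxSize m : ℝ)) * tableErr f xstar S.table + ℓ ^ 2 / minSize m * D)
        / (n * ℓ ^ 2) = (1 - 1 / (maxSize m : ℝ)) * (tableErr f xstar S.table / (n * ℓ ^ 2))
          + 1 / minSize m * (D / n) := by
      field_simp
    rw [e2]
    gcongr
  · refine (mul_le_mul_of_nonneg_left hEW' (by positivity)).trans (le_of_eq ?_)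
    field_simp
  · rw [div_le_iff₀ (by positivity)]
    have e1 : D ≤ (2 * optErr πr xstar x + 2 * (consErr πr x / (n * ⨅ i, πr i))) * n :=
      (div_le_iff₀ hn).1 hDn
    have e2 := mul_le_mul_of_nonneg_left e1 (show 0 ≤ 2 * ℓ ^ 2 by positivity)
    refine hE.trans ((add_le_add_left e2 _).trans (le_of_eq ?_))
    field_simp
    ring

end Step

/-! ### Expectations along the random run -/

section Run

variable {n p : ℕ} {m : Fin n → ℕ} {f : (i : Fin n) → Fin (m i) → Vec p → ℝ}
  {A B : Matrix (Fin n) (Fin n) ℝ} {α : ℝ} {c d : ℕ} {x₀ : Fin n → Vec p}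

lemma run_congr {s s' : ℕ → (i : Fin n) → Fin (m i)} {k : ℕ} (h : ∀ t ≤ k, s t = s' t) :
    run f A B α c d x₀ s k = run f A B α c d x₀ s' k := by
  induction k with
  | zero => rfl
  | succ k ih => rw [run, run, ih fun t ht => h t (by omega), h (k + 1) le_rfl]

/-- The trackers and the gradient estimates have the same sum. -/
lemma run_sum_eq {π : Fin n → ℝ} (hB : ColPair B π) (s : ℕ → (i : Fin n) → Fin (m i)) (k : ℕ) :
    ∑ i, (run f A B α c d x₀ s k).w i = ∑ i, (run f A B α c d x₀ s k).g i := by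
  induction k with
  | zero => rfl
  | succ k ih =>
    rw [run]
    simp only [step]
    rw [hB.sum_pow, Finset.sum_sub_distrib, Finset.sum_add_distrib, ih]
    abel

lemma run_evals (s : ℕ → (i : Fin n) → Fin (m i)) (k : ℕ) (i : Fin n) :
    (run f A B α c d x₀ s k).evals i = m i + k := by
  induction k with
  | zero => rfl
  | succ k ih => rw [run]; simp only [step]; rw [ih]; ring

lemma run_rounds (s : ℕ → (i : Fin n) → Fin (m i)) (k : ℕ) :
    (run f A B α c d x₀ s k).rounds = (c + d) * k := by
  induction k with
  | zero => rfl
  | succ k ih => rw [run]; simp only [step]; rw [ih]; ring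

variable {Ω : Type*} {s : ℕ → (i : Fin n) → Ω → Fin (m i)}

/-- Index set of the draws of iterations `0, …, k`. -/
def pastIndices (n k : ℕ) : Finset (ℕ × Fin n) := Finset.range (k + 1) ×ˢ Finset.univ

/-- The draws of iterations `0, …, k`. -/
def history (s : ℕ → (i : Fin n) → Ω → Fin (m i)) (k : ℕ) (ω : Ω) :
    (q : pastIndices n k) → Fin (m q.1.2) := fun q => s q.1.1 q.1.2 ω

/-- A function of the state after `k` iterations is a function of the history. -/
lemma exists_history_eq {β : Type*} (hm : ∀ i, 0 < m i) (F : State n p m → β) (k : ℕ) :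
    ∃ φ : ((q : pastIndices n k) → Fin (m q.1.2)) → β,
      (fun ω => F (randomRun f A B α c d x₀ s k ω)) = φ ∘ history s k := by
  refine ⟨fun h => F (run f A B α c d x₀ (fun t i => if ht : (t, i) ∈ pastIndices n k then
    h ⟨(t, i), ht⟩ else ⟨0, hm i⟩) k), ?_⟩
  ext1 ω
  simp only [Function.comp, randomRun]
  congr 1
  refine run_congr fun t ht => ?_
  ext1 i
  have : (t, i) ∈ pastIndices n k := by
    simp only [pastIndices, Finset.mem_product, Finset.mem_range, Finset.mem_univ, and_true]
    omega
  rw [dif_pos this]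
  rfl

variable [MeasurableSpace Ω] {P : Measure Ω}

lemma IsUniformSampling.measurable_history (hs : IsUniformSampling P s) (k : ℕ) :
    Measurable (history s k) :=
  measurable_pi_lambda _ fun q => hs.measurable q.1.1 q.1.2

lemma IsUniformSampling.integrable_run [IsProbabilityMeasure P] (hs : IsUniformSampling P s) (hm : ∀ i, 0 < m i)
    (F : State n p m → ℝ) (k : ℕ) :
    Integrable (fun ω => F (randomRun f A B α c d x₀ s k ω)) P := by
  obtain ⟨φ, hφ⟩ := exists_history_eq (f := f) (A := A) (B := B) (α := α) (c := c) (d := d)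
    (x₀ := x₀) (s := s) hm F k
  rw [hφ]
  have hmeas := hs.measurable_history k
  have : IsProbabilityMeasure (P.map (history s k)) :=
    Measure.isProbabilityMeasure_map hmeas.aemeasurable
  exact (Integrable.of_finite (μ := P.map (history s k)) (f := φ)).comp_measurable hmeas

/-- The probability of the index tuple `a` in iteration `k`. -/
noncomputable def drawWeight (P : Measure Ω) (s : ℕ → (i : Fin n) → Ω → Fin (m i)) (k : ℕ)
    (a : (i : Fin n) → Fin (m i)) : ℝ := P.real ((fun ω i => s k i ω) ⁻¹' {a})

lemma IsUniformSampling.measurable_draw (hs : IsUniformSampling P s) (k : ℕ) :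
    Measurable fun ω i => s k i ω :=
  measurable_pi_lambda _ fun i => hs.measurable k i

lemma IsUniformSampling.uniformWeights [IsProbabilityMeasure P] (hs : IsUniformSampling P s) (k : ℕ) :
    UniformWeights m (drawWeight P s k) where
  nonneg a := measureReal_nonneg
  marginal i j := by
    rw [← Finset.sum_filter]
    unfold drawWeight
    rw [sum_measureReal_preimage_singleton _ fun a _ =>
      hs.measurable_draw k (measurableSet_singleton a)]
    have e : (fun ω i => s k i ω) ⁻¹' ↑(Finset.univ.filter fun a : (i : Fin n) → Fin (m i) =>
        a i = j) = s k i ⁻¹' {j} := by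
      ext ω; simp
    rw [e, measureReal_def, hs.uniform]
    simp

/-- Conditioning on the draw of the next iteration, which is independent of the past. -/
lemma IsUniformSampling.integral_run_succ [IsProbabilityMeasure P]
    (hs : IsUniformSampling P s) (hm : ∀ i, 0 < m i)
    (F : State n p m → ℝ) (k : ℕ) :
    ∫ ω, F (randomRun f A B α c d x₀ s (k + 1) ω) ∂P
      = ∫ ω, ∑ a, drawWeight P s (k + 1) a
          * F (step f A B α c d a (randomRun f A B α c d x₀ s k ω)) ∂P := by
  classical
  set draw : Ω → (i : Fin n) → Fin (m i) := fun ω i => s (k + 1) i ω with hdraw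
  have hdm : Measurable draw := hs.measurable_draw (k + 1)
  have hsplit : ∀ ω, F (randomRun f A B α c d x₀ s (k + 1) ω)
      = ∑ a, (draw ⁻¹' {a}).indicator (fun _ => (1 : ℝ)) ω
        * F (step f A B α c d a (randomRun f A B α c d x₀ s k ω)) := by
    intro ω
    rw [Finset.sum_eq_single (draw ω)]
    · simp only [Set.indicator, Set.mem_preimage, Set.mem_singleton_iff, if_true, one_mul]
      rfl
    · intro a _ ha
      have : ω ∉ draw ⁻¹' {a} := fun h => ha (Eq.symm h)
      rw [Set.indicator_of_notMem this, zero_mul]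
    · simp
  have hind : ∀ a, ∫ ω, (draw ⁻¹' {a}).indicator (fun _ => (1 : ℝ)) ω
        * F (step f A B α c d a (randomRun f A B α c d x₀ s k ω)) ∂P
      = ∫ ω, drawWeight P s (k + 1) a
        * F (step f A B α c d a (randomRun f A B α c d x₀ s k ω)) ∂P := by
    intro a
    obtain ⟨φ, hφ⟩ := exists_history_eq (f := f) (A := A) (B := B) (α := α) (c := c) (d := d)
      (x₀ := x₀) (s := s) hm (fun S => F (step f A B α c d a S)) k
    set T : Finset (ℕ × Fin n) := {k + 1} ×ˢ Finset.univ with hT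
    have hdisj : Disjoint (pastIndices n k) T := by
      rw [Finset.disjoint_left]
      intro q hq hq'
      simp only [pastIndices, hT, Finset.mem_product, Finset.mem_range, Finset.mem_singleton,
        Finset.mem_univ, and_true] at hq hq'
      omega
    have hI := hs.indep.indepFun_finset _ _ hdisj fun q => hs.measurable q.1 q.2
    have hmemT : ∀ i : Fin n, (k + 1, i) ∈ T := fun i => by simp [hT]
    have hI2 : IndepFun (fun ω => (draw ⁻¹' {a}).indicator (fun _ => (1 : ℝ)) ω)
        (fun ω => F (step f A B α c d a (randomRun f A B α c d x₀ s k ω))) P := by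
      have h3 := hI.symm.comp
        (φ := fun b : (q : T) → Fin (m q.1.2) =>
          if (fun i => b ⟨(k + 1, i), hmemT i⟩) = a then (1 : ℝ) else 0)
        (ψ := φ) (measurable_of_finite _) (measurable_of_finite _)
      have e : (fun ω => (draw ⁻¹' {a}).indicator (fun _ => (1 : ℝ)) ω)
          = fun ω => if draw ω = a then 1 else 0 := by
        ext ω; simp [Set.indicator]
      rw [hφ, e]
      exact h3
    rw [hI2.integral_fun_mul_eq_mul_integral
      ((measurable_const.indicator (hdm (measurableSet_singleton a))).aestronglyMeasurable)
      (hs.integrable_run hm (fun S => F (step f A B α c d a S)) k).aestronglyMeasurable,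
      integral_const_mul, integral_indicator_const _ (hdm (measurableSet_singleton a))]
    simp only [smul_eq_mul, mul_one]
    rfl
  simp_rw [hsplit]
  rw [integral_finsetSum, integral_finsetSum]
  · exact Finset.sum_congr rfl fun a _ => hind a
  · intro a _
    exact (hs.integrable_run hm (fun S => F (step f A B α c d a S)) k).const_mul _
  · intro a _
    refine (hs.integrable_run hm (fun S => F (step f A B α c d a S)) k).bdd_mul (c := 1)
      ((measurable_const.indicator (hdm (measurableSet_singleton a))).aestronglyMeasurable)
      (Filter.Eventually.of_forall fun ω => ?_)
    by_cases h : ω ∈ draw ⁻¹' {a}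
    · rw [Set.indicator_of_mem h]; simp
    · rw [Set.indicator_of_notMem h]; simp

end Run

section Convergence

variable {n p : ℕ} {m : Fin n → ℕ} {f : (i : Fin n) → Fin (m i) → Vec p → ℝ} {μ ℓ : ℝ}
  {A B : Matrix (Fin n) (Fin n) ℝ} {πr πc : Fin n → ℝ} {xstar : Vec p}

lemma Setting.rate_pos (H : Setting m f μ ℓ A B πr πc xstar) {α : ℝ} (hα : 0 < α) :
    0 < rate m μ πr πc α := by
  have hθ := H.θ_pos
  have hn : (0 : ℝ) < n := by linarith [H.one_le_n]
  have hM : (0 : ℝ) < maxSize m := by linarith [H.one_le_min, H.min_le_max]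
  have hμ := H.μ_pos
  exact lt_min (by positivity) (by positivity)

lemma Setting.rate_le (H : Setting m f μ ℓ A B πr πc xstar) (α : ℝ) :
    rate m μ πr πc α ≤ 1 / 4 :=
  (min_le_right _ _).trans
    (one_div_le_one_div_of_le (by norm_num) (by linarith [H.one_le_min, H.min_le_max]))

lemma Setting.stateLyapunov_nonneg (H : Setting m f μ ℓ A B πr πc xstar) {α : ℝ} (hα : 0 < α)
    (c : ℕ) (S : State n p m) : 0 ≤ stateLyapunov f μ ℓ A πr πc xstar α c S := by
  have hθ := H.θ_pos
  have hn : (0 : ℝ) < n := by linarith [H.one_le_n]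
  have hμ := H.μ_pos
  have hri := iInf_pos_of_pos H.n_pos H.row.pos
  have hrs : 0 < ⨆ i, πr i := hri.trans_le (iInf_le_iSup H.n_pos _)
  have h1 := optErr_nonneg πr xstar (nextX A α c S)
  have h2 := consErr_nonneg H.row.pos (nextX A α c S)
  have h3 := tableErr_nonneg f xstar S.table
  have h4 := trackErr_nonneg H.col.pos S.w
  have h5 := gradErr_nonneg f xstar S.g
  unfold stateLyapunov lyapunov
  positivity

/-- The Lyapunov function of a state controls the distance of the next iterates from `xstar`. -/
lemma Setting.norm_nextX_sub_sq_le (H : Setting m f μ ℓ A B πr πc xstar) {α : ℝ} (hα : 0 < α)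
    (c : ℕ) (S : State n p m) (i : Fin n) :
    ‖nextX A α c S i - xstar‖ ^ 2
      ≤ 2 * n * (1 + 1 / (40 * (n * dotProduct πr πc * α * μ * (ℓ / μ) ^ 2)))
        * stateLyapunov f μ ℓ A πr πc xstar α c S := by
  have hθ := H.θ_pos
  have hn : (0 : ℝ) < n := by linarith [H.one_le_n]
  have hμ := H.μ_pos
  have hℓ := H.ℓ_pos
  have hri := iInf_pos_of_pos H.n_pos H.row.pos
  have hrs : 0 < ⨆ i, πr i := hri.trans_le (iInf_le_iSup H.n_pos _)
  have h1 := optErr_nonneg πr xstar (nextX A α c S)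
  have h2 := consErr_nonneg H.row.pos (nextX A α c S)
  have h3 := tableErr_nonneg f xstar S.table
  have h4 := trackErr_nonneg H.col.pos S.w
  have h5 := gradErr_nonneg f xstar S.g
  have hD := (sum_norm_sub_sq_le hri (iInf_le_apply πr) xstar (nextX A α c S)).2
  have hi := Finset.single_le_sum (f := fun i => ‖nextX A α c S i - xstar‖ ^ 2)
    (fun j _ => sq_nonneg _) (Finset.mem_univ i)
  have hP : 0 < 40 * (n * dotProduct πr πc * α * μ * (ℓ / μ) ^ 2) := by positivity
  have e1 : consErr πr (nextX A α c S) / ⨅ i, πr i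
      = n * (consErr πr (nextX A α c S) / (n * ⨅ i, πr i)) := by field_simp
  rw [e1] at hD
  set V := stateLyapunov f μ ℓ A πr πc xstar α c S with hV
  set X := consErr πr (nextX A α c S) / (n * ⨅ i, πr i) with hX
  have hX0 : 0 ≤ X := by positivity
  have hV1 : optErr πr xstar (nextX A α c S)
      + 40 * (n * dotProduct πr πc * α * μ * (ℓ / μ) ^ 2) * X ≤ V := by
    rw [hV]
    unfold stateLyapunov lyapunov
    have q1 : 0 ≤ n * dotProduct πr πc * α * μ * minSize m / 8
        * (tableErr f xstar S.table / (n * ℓ ^ 2)) := by positivity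
    have q2 : 0 ≤ 40 * (n * dotProduct πr πc * α * μ * (ℓ / μ) ^ 2)
        * ((⨆ i, πr i) / (n ^ 2 * dotProduct πr πc * ℓ ^ 2) * trackErr πc S.w) := by positivity
    have q3 : 0 ≤ n * dotProduct πr πc * α * μ * minSize m / (1000 * maxSize m)
        * (gradErr f xstar S.g / (n * ℓ ^ 2)) := by positivity
    linarith
  have hX1 : X ≤ 1 / (40 * (n * dotProduct πr πc * α * μ * (ℓ / μ) ^ 2)) * V := by
    rw [one_div, ← div_eq_inv_mul, le_div_iff₀ hP]
    linarith
  have hY1 : optErr πr xstar (nextX A α c S) ≤ V := by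
    have : 0 ≤ 40 * (n * dotProduct πr πc * α * μ * (ℓ / μ) ^ 2) * X := by positivity
    linarith
  have e2 := mul_le_mul_of_nonneg_left (add_le_add hY1 hX1) (show 0 ≤ 2 * (n : ℝ) by positivity)
  linarith

variable {Ω : Type*} [MeasurableSpace Ω] {P : Measure Ω} [IsProbabilityMeasure P]
  {s : ℕ → (i : Fin n) → Ω → Fin (m i)}

lemma Setting.integral_stateLyapunov_le (H : Setting m f μ ℓ A B πr πc xstar) {c d : ℕ}
    (hc1 : 1 ≤ c) (hd1 : 1 ≤ d) (hd : dBar m μ ℓ B πr πc ≤ d)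
    (hc : cBar m μ ℓ A B πr πc d ≤ c) {α : ℝ}
    (hα0 : 0 < α) (hα1 : α ≤ stepBound m μ ℓ πr πc) (x₀ : Fin n → Vec p)
    (hs : IsUniformSampling P s) (k : ℕ) :
    ∫ ω, stateLyapunov f μ ℓ A πr πc xstar α c (randomRun f A B α c d x₀ s k ω) ∂P
      ≤ stateLyapunov f μ ℓ A πr πc xstar α c (initState f x₀) * (1 - rate m μ πr πc α) ^ k := by
  induction k with
  | zero => simp [randomRun, run]
  | succ k ih =>
    set V := stateLyapunov f μ ℓ A πr πc xstar α c with hV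
    rw [hs.integral_run_succ H.m_pos V k]
    have h1 : ∫ ω, ∑ a, drawWeight P s (k + 1) a
          * V (step f A B α c d a (randomRun f A B α c d x₀ s k ω)) ∂P
        ≤ ∫ ω, (1 - rate m μ πr πc α) * V (randomRun f A B α c d x₀ s k ω) ∂P := by
      refine integral_mono
        (hs.integrable_run H.m_pos
          (fun S => ∑ a, drawWeight P s (k + 1) a * V (step f A B α c d a S)) k)
        ((hs.integrable_run H.m_pos V k).const_mul _) fun ω => ?_
      exact H.step_contraction hc1 hd1 hd hc hα0 hα1 (hs.uniformWeights (k + 1))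
        (run_sum_eq H.col _ k)
    rw [integral_const_mul] at h1
    have h2 := mul_le_mul_of_nonneg_left ih
      (show 0 ≤ 1 - rate m μ πr πc α by linarith [H.rate_le α])
    rw [pow_succ]
    linarith

/-- Linear convergence at rate `1 - ρ`, with a constant that does not depend on the probability
space. -/
lemma Setting.exists_linear_bound (H : Setting m f μ ℓ A B πr πc xstar) {c d : ℕ}
    (hc1 : 1 ≤ c) (hd1 : 1 ≤ d) (hd : dBar m μ ℓ B πr πc ≤ d)
    (hc : cBar m μ ℓ A B πr πc d ≤ c) {α : ℝ}
    (hα0 : 0 < α) (hα1 : α ≤ stepBound m μ ℓ πr πc) (x₀ : Fin n → Vec p) :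
    ∃ C : ℝ, 1 ≤ C ∧ ∀ {Ω : Type*} [MeasurableSpace Ω] (P : Measure Ω) [IsProbabilityMeasure P]
      (s : ℕ → (i : Fin n) → Ω → Fin (m i)) (_ : IsUniformSampling P s) (k : ℕ) (i : Fin n),
      ∫ ω, ‖(randomRun f A B α c d x₀ s k ω).x i - xstar‖ ^ 2 ∂P
        ≤ C * (1 - rate m μ πr πc α) ^ k := by
  set V := stateLyapunov f μ ℓ A πr πc xstar α c with hV
  set K := 2 * n * (1 + 1 / (40 * (n * dotProduct πr πc * α * μ * (ℓ / μ) ^ 2))) with hK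
  have hρ := H.rate_le α
  set γ := 1 - rate m μ πr πc α with hγ
  have hγ0 : 0 < γ := by linarith
  have hθ := H.θ_pos
  have hμ := H.μ_pos
  have hℓ := H.ℓ_pos
  have hK0 : 0 ≤ K := by positivity
  have hV0 : 0 ≤ V (initState f x₀) := H.stateLyapunov_nonneg hα0 c _
  have hsum0 : 0 ≤ ∑ i, ‖x₀ i - xstar‖ ^ 2 := Finset.sum_nonneg fun i _ => sq_nonneg _
  have hKV : 0 ≤ K * V (initState f x₀) / γ := by positivity
  refine ⟨1 + ∑ i, ‖x₀ i - xstar‖ ^ 2 + K * V (initState f x₀) / γ, by linarith, ?_⟩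
  intro Ω _ P _ s hs k i
  cases k with
  | zero =>
    have hi := Finset.single_le_sum (f := fun i => ‖x₀ i - xstar‖ ^ 2)
      (fun j _ => sq_nonneg _) (Finset.mem_univ i)
    change ∫ _, ‖x₀ i - xstar‖ ^ 2 ∂P ≤ _
    rw [integral_const, probReal_univ, one_smul, pow_zero, mul_one]
    linarith
  | succ k =>
    have h1 : ∫ ω, ‖(randomRun f A B α c d x₀ s (k + 1) ω).x i - xstar‖ ^ 2 ∂P
        ≤ ∫ ω, K * V (randomRun f A B α c d x₀ s k ω) ∂P := by
      refine integral_mono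
        (hs.integrable_run H.m_pos (fun S => ‖S.x i - xstar‖ ^ 2) (k + 1))
        ((hs.integrable_run H.m_pos V k).const_mul _) fun ω => ?_
      exact H.norm_nextX_sub_sq_le hα0 c (randomRun f A B α c d x₀ s k ω) i
    rw [integral_const_mul] at h1
    have h2 := mul_le_mul_of_nonneg_left
      (H.integral_stateLyapunov_le hc1 hd1 hd hc hα0 hα1 x₀ hs k) hK0
    have h3 : K * (V (initState f x₀) * γ ^ k) = K * V (initState f x₀) / γ * γ ^ (k + 1) := by
      rw [pow_succ]; field_simp
    have h4 : 0 ≤ (1 + ∑ i, ‖x₀ i - xstar‖ ^ 2) * γ ^ (k + 1) := by positivity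
    rw [add_mul]
    linarith

/-- At the largest step size, the rate is at least the inverse complexity factor up to a universal
constant. -/
lemma Setting.inv_complexityFactor_le_rate (H : Setting m f μ ℓ A B πr πc xstar) :
    1 ≤ complexityFactor m μ ℓ πr πc ∧ (maxSize m : ℝ) ≤ complexityFactor m μ ℓ πr πc ∧
    1 / (576 * complexityFactor m μ ℓ πr πc)
      ≤ rate m μ πr πc (stepBound m μ ℓ πr πc) := by
  have hθ := H.θ_pos
  have hn1 := H.one_le_n
  have hn : (0 : ℝ) < n := by linarith
  have hm := H.one_le_min
  have hm0 : (0 : ℝ) < minSize m := by linarith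
  have hM1 : (1 : ℝ) ≤ maxSize m := hm.trans H.min_le_max
  have hM : (0 : ℝ) < maxSize m := by linarith
  have hμ := H.μ_pos
  have hℓ := H.ℓ_pos
  have hr := one_le_spread H.n_pos H.row.pos
  have hc := one_le_spread H.n_pos H.col.pos
  have hsq : 0 < √(spread πr * spread πc) := Real.sqrt_pos.2 (by positivity)
  have hF1 : ℓ / μ * directivity πr πc ≤ complexityFactor m μ ℓ πr πc := le_max_left _ _
  have hF2 : (ℓ / μ) ^ 2 * maxSize m / minSize m ≤ complexityFactor m μ ℓ πr πc :=
    (le_max_left _ _).trans (le_max_right _ _)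
  have hF3 : (maxSize m : ℝ) ≤ complexityFactor m μ ℓ πr πc :=
    (le_max_right _ _).trans (le_max_right _ _)
  generalize complexityFactor m μ ℓ πr πc = Φ at *
  have hΦ1 : 1 ≤ Φ := by linarith
  have hΦ : 0 < Φ := by linarith
  refine ⟨hΦ1, hF3, ?_⟩
  have hη : 1 / (288 * Φ) ≤ n * dotProduct πr πc * stepBound m μ ℓ πr πc * μ := by
    have hpos : 0 < n * dotProduct πr πc * μ := by positivity
    have hgoal : 1 / (288 * Φ) / (n * dotProduct πr πc * μ) ≤ stepBound m μ ℓ πr πc := by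
      unfold stepBound
      refine le_min ?_ (le_min ?_ ?_)
      · rw [div_div, div_le_div_iff₀ (by positivity) (by positivity), one_mul, one_mul]
        have h1 := mul_le_mul_of_nonneg_right hF1
          (show 0 ≤ n * dotProduct πr πc * μ by positivity)
        have e1 : ℓ / μ * directivity πr πc * (n * dotProduct πr πc * μ)
            = ℓ * √(spread πr * spread πc) := by
          unfold directivity; field_simp
        rw [e1] at h1
        have : 0 ≤ ℓ * √(spread πr * spread πc) := by positivity
        linarith
      · rw [div_div, div_le_div_iff₀ (by positivity) (by positivity), one_mul]
        have h1 := mul_le_mul_of_nonneg_right hF2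
          (show 0 ≤ minSize m * (n * dotProduct πr πc * μ) by positivity)
        have e1 : (ℓ / μ) ^ 2 * maxSize m / minSize m * (minSize m * (n * dotProduct πr πc * μ))
            = maxSize m * n * (ℓ / μ) * ℓ * dotProduct πr πc := by
          field_simp
        rw [e1] at h1
        linarith
      · rw [div_div, div_le_div_iff₀ (by positivity) (by positivity), one_mul, one_mul]
        have h1 : (maxSize m : ℝ) ≤ Φ * n := by
          have := mul_le_mul_of_nonneg_left hn1 hΦ.le
          linarith
        have h2 := mul_le_mul_of_nonneg_right h1 (show 0 ≤ μ * dotProduct πr πc by positivity)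
        have : 0 ≤ maxSize m * (μ * dotProduct πr πc) := by positivity
        linarith
    rw [div_le_iff₀ hpos] at hgoal
    linarith
  refine le_min ?_ ?_
  · have e : 1 / (576 * Φ) = 1 / (288 * Φ) / 2 := by field_simp; norm_num
    rw [e]
    linarith
  · exact one_div_le_one_div_of_le (by positivity) (by linarith)

end Convergence

/-! ### Iteration count -/

/-- A geometric decay at rate `1 - ρ` reaches accuracy `ε` after `T` iterations, where `T` is
proportional to `log (1 / ε) / ρ` once `log (1 / ε)` dominates `log C`. -/
lemma mul_pow_le_of_log_le {C Φ ρ L : ℝ} (hC : 1 ≤ C) (hΦ : 0 < Φ)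
    (hρ : 1 / (576 * Φ) ≤ ρ) (hρ1 : ρ ≤ 1) (hL : Real.log C ≤ L) {k : ℕ}
    (hk : 1152 * Φ * L ≤ k) : C * (1 - ρ) ^ k ≤ Real.exp (-L) := by
  have h1 : (1 - ρ) ^ k ≤ Real.exp (-ρ) ^ k :=
    pow_le_pow_left₀ (by linarith) (by linarith [Real.add_one_le_exp (-ρ)]) k
  rw [← Real.exp_nat_mul] at h1
  have h2 : C = Real.exp (Real.log C) := (Real.exp_log (by linarith)).symm
  have h3 : 2 * L ≤ k * ρ := by
    have hL0 : 0 ≤ L := (Real.log_nonneg hC).trans hL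
    calc 2 * L = 1152 * Φ * L * (1 / (576 * Φ)) := by field_simp; ring
      _ ≤ k * ρ := mul_le_mul hk hρ (by positivity) (Nat.cast_nonneg k)
  calc C * (1 - ρ) ^ k ≤ C * Real.exp (k * -ρ) := by gcongr
    _ = Real.exp (Real.log C + k * -ρ) := by rw [Real.exp_add, ← h2]
    _ ≤ Real.exp (-L) := by
      gcongr
      linarith

end ABSAGA

theorem theorem1 :
    ∃ K : ℝ, 0 < K ∧
      ∀ (n p : ℕ) (_ : 0 < n) (_ : 0 < p)
        -- the problem
        (m : Fin n → ℕ) (_ : ∀ i, 0 < m i)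
        (f : (i : Fin n) → Fin (m i) → Vec p → ℝ)
        (μ ℓ : ℝ) (_ : 0 < μ)
        (_ : StrongConvexOn Set.univ μ (globalCost f))
        (_ : ∀ i j, IsSmooth ℓ (f i j))
        -- the network
        (G : Digraph (Fin n)) (_ : StronglyConnected G)
        (A B : Matrix (Fin n) (Fin n) ℝ)
        (_ : IsRowWeights G A) (_ : IsColWeights G B)
        (πr πc : Fin n → ℝ)
        (_ : IsLeftPerron A πr) (_ : IsRightPerron B πc),
        1 ≤ directivity πr πc ∧
        0 < stepBound m μ ℓ πr πc ∧
        sigmaRow A πr < 1 ∧ sigmaCol B πc < 1 ∧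
        -- the unique global minimizer
        ∃ xstar : Vec p, (∀ y, globalCost f xstar ≤ globalCost f y) ∧
          (∀ z, (∀ y, globalCost f z ≤ globalCost f y) → z = xstar) ∧
          -- the numbers of communication rounds
          ∀ (c d : ℕ) (_ : 1 ≤ c) (_ : 1 ≤ d)
            (_ : dBar m μ ℓ B πr πc ≤ d) (_ : cBar m μ ℓ A B πr πc d ≤ c),
            -- linear convergence for every smaller step size
            (∀ α : ℝ, 0 < α → α < stepBound m μ ℓ πr πc →
              ∃ γ : ℝ, 0 ≤ γ ∧ γ < 1 ∧ ∀ x₀ : Fin n → Vec p, ∃ C : ℝ,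
                ∀ (Ω : Type*) [MeasurableSpace Ω] (P : Measure Ω) [IsProbabilityMeasure P]
                  (s : ℕ → (i : Fin n) → Ω → Fin (m i)) (_ : IsUniformSampling P s),
                  ∀ (k : ℕ) (i : Fin n),
                    Integrable
                      (fun ω => ‖(randomRun f A B α c d x₀ s k ω).x i - xstar‖ ^ 2) P ∧
                    ∫ ω, ‖(randomRun f A B α c d x₀ s k ω).x i - xstar‖ ^ 2 ∂P ≤ C * γ ^ k) ∧
            -- complexity for the largest step size
            (∀ x₀ : Fin n → Vec p, ∃ ε₀ : ℝ, 0 < ε₀ ∧ ε₀ < 1 ∧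
              ∀ ε : ℝ, 0 < ε → ε ≤ ε₀ → ∃ T : ℕ,
                ∀ (Ω : Type*) [MeasurableSpace Ω] (P : Measure Ω) [IsProbabilityMeasure P]
                  (s : ℕ → (i : Fin n) → Ω → Fin (m i)) (_ : IsUniformSampling P s),
                  (∀ ω i,
                    (((randomRun f A B (stepBound m μ ℓ πr πc) c d x₀ s T ω).evals i : ℕ) : ℝ) ≤
                      K * complexityFactor m μ ℓ πr πc * Real.log (1 / ε)) ∧
                  (∀ ω k,
                    (randomRun f A B (stepBound m μ ℓ πr πc) c d x₀ s k ω).rounds =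
                      (c + d) * k) ∧
                  ∀ (k : ℕ) (i : Fin n), T ≤ k →
                    Integrable
                      (fun ω => ‖(randomRun f A B (stepBound m μ ℓ πr πc) c d x₀ s k ω).x i
                        - xstar‖ ^ 2) P ∧
                    ∫ ω, ‖(randomRun f A B (stepBound m μ ℓ πr πc) c d x₀ s k ω).x i
                      - xstar‖ ^ 2 ∂P ≤ ε) := by
  -- `1152` for the iterations, `1` for rounding up, `1` for the initial `m i ≤ M` gradients
  refine ⟨1154, by norm_num, ?_⟩
  intro n p hn hp m hm f μ ℓ hμ hconv hsm G hG A B hA hB πr πc hπr hπc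
  have hrow := hA.rowPair hG hπr
  have hcol := hB.colPair hG hπc
  have hgrad := fun x => hasGradientAt_globalCost (f := f) (fun i j => (hsm i j).1) x
  have hmono := strongConvex_monotone hconv hgrad
  have hlip := globalGrad_lipschitz hn hm hsm
  have hμℓ : μ ≤ ℓ := le_lipschitz_of_monotone hp hmono hlip
  obtain ⟨xstar, hstar⟩ := exists_zero_of_monotone hμ (hμ.trans_le hμℓ) hmono hlip
  have H : Setting m f μ ℓ A B πr πc xstar :=
    ⟨hn, hm, hμ, hμℓ, hsm, hmono, hstar, hrow, hcol⟩
  have hgrowth : ∀ y, globalCost f xstar + μ / 2 * ‖y - xstar‖ ^ 2 ≤ globalCost f y := by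
    intro y
    have h1 := strongConvex_first_order hconv (hgrad xstar) y
    rwa [hstar, inner_zero_left, add_zero] at h1
  refine ⟨one_le_directivity hn hrow.pos hcol.pos hrow.sum_one hcol.sum_one, H.stepBound_pos,
    hrow.sigmaRow_lt_one, H.sigmaCol_lt_one, xstar, ?_, ?_, ?_⟩
  · intro y
    have h1 := hgrowth y
    have : 0 ≤ μ / 2 * ‖y - xstar‖ ^ 2 := by positivity
    linarith
  · intro z hz
    have h1 := hgrowth z
    have h2 := hz xstar
    have h3 : μ / 2 * ‖z - xstar‖ ^ 2 ≤ μ / 2 * 0 := by linarith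
    have h4 := le_of_mul_le_mul_left h3 (by positivity)
    have h5 : ‖z - xstar‖ = 0 :=
      pow_eq_zero_iff two_ne_zero |>.1 (le_antisymm h4 (sq_nonneg _))
    exact sub_eq_zero.1 (norm_eq_zero.1 h5)
  intro c d hc1 hd1 hd hc
  refine ⟨?_, ?_⟩
  · intro α hα0 hα1
    refine ⟨1 - rate m μ πr πc α, by linarith [H.rate_le α], by linarith [H.rate_pos hα0], ?_⟩
    intro x₀
    obtain ⟨C, _, hC⟩ := H.exists_linear_bound hc1 hd1 hd hc hα0 hα1.le x₀
    refine ⟨C, fun Ω _ P _ s hs k i => ⟨?_, hC P s hs k i⟩⟩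
    exact hs.integrable_run hm (fun S => ‖S.x i - xstar‖ ^ 2) k
  · intro x₀
    have hα0 := H.stepBound_pos
    obtain ⟨C, hC1, hC⟩ := H.exists_linear_bound hc1 hd1 hd hc hα0 le_rfl x₀
    obtain ⟨hΦ1, hΦM, hrate⟩ := H.inv_complexityFactor_le_rate
    set Φ := complexityFactor m μ ℓ πr πc with hΦ
    have hlogC := Real.log_nonneg hC1
    -- the threshold makes `log (1 / ε)` at least `1` and at least `log C`
    refine ⟨Real.exp (-(1 + Real.log C)), Real.exp_pos _,
      Real.exp_lt_one_iff.2 (by linarith), fun ε hε0 hε => ?_⟩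
    have hL : 1 + Real.log C ≤ Real.log (1 / ε) := by
      have h1 := Real.log_le_log hε0 hε
      rw [Real.log_exp] at h1
      rw [one_div, Real.log_inv]
      linarith
    have hεL : Real.exp (-Real.log (1 / ε)) = ε := by
      rw [one_div, Real.log_inv, neg_neg, Real.exp_log hε0]
    set L := Real.log (1 / ε) with hLdef
    have hΦL : 1 ≤ Φ * L := one_le_mul_of_one_le_of_one_le hΦ1 (by linarith)
    refine ⟨⌈1152 * Φ * L⌉₊, fun Ω _ P _ s hs => ⟨?_, fun ω k => run_rounds _ k, ?_⟩⟩
    · intro ω i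
      rw [randomRun, run_evals]
      have h1 := (Nat.ceil_lt_add_one (show 0 ≤ 1152 * Φ * L by linarith)).le
      have h2 : (m i : ℝ) ≤ maxSize m := by exact_mod_cast le_maxSize m i
      have h3 : Φ ≤ Φ * L := le_mul_of_one_le_right (by linarith) (by linarith)
      push_cast
      linarith
    · intro k i hk
      refine ⟨hs.integrable_run hm (fun S => ‖S.x i - xstar‖ ^ 2) k, ?_⟩
      refine (hC P s hs k i).trans ?_
      rw [← hεL]
      have hρ1 := H.rate_le (stepBound m μ ℓ πr πc)
      exact mul_pow_le_of_log_le hC1 (by linarith) hrate (by linarith) (by linarith)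
        ((Nat.le_ceil _).trans (by exact_mod_cast hk))
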